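/- **Setting.** Let $S^2\subset\mathbb R^3$ be the unit sphere with surface measure $\omega$, $|x-y|=\sqrt{2(1-x\cdot y)}$, and let $C(S^2)$ be the space of real continuous functions with the norm $\|\cdot\|_\infty$. Let $K\in C(S^2\times S^2)$ be real, and let $h$ be a real function that is continuous on $(0,2]$ and weakly singular: $|h(r)|\le M r^{\alpha-2}$ for $0<r\le 2$, with some $M>0$, $\alpha\in(0,2]$. Assume that $t\mapsto h(\sqrt{2(1-t)})$ belongs to $L^1(-1,1)\cap L^2(-1,1)$. Consider $$\varphi(x)-\int_{S^2}h(|x-y|)K(x,y)\varphi(y)\,d\omega(y)=f(x),\qquad x\in S^2, \tag{1}$$ and assume that for $f=0$ it has no continuous solution other than $\varphi=0$. Let $\{Y_{\ell,k}:\ell\ge 0,\ 1\le k\le 2\ell+1\}$ be an $L^2(S^2)$-orthonormal system of real spherical harmonics, where for each $\ell$ the $Y_{\ell,k}$ form a basis of the spherical harmonics of degree $\ell$ (restrictions to $S^2$ of harmonic homogeneous polynomials of degree $\ell$). Let $\mathbb P_n$ be the span of all spherical harmonics of degree at most $n$. For $g\in C(S^2)$ put $E_n(g)=\inf_{\chi\in\mathbb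 P_n}\|g-\chi\|_\infty$; a best approximation of $g$ in $\mathbb P_n$ is a $\chi^*\in\mathbb P_n$ with $\|g-\chi^*\|_\infty=E_n(g)$. Let $\Gamma$ be the set of triples $\gamma=(m,n,\eta)$, $\eta\in[0,1)$, taken together with distinct points $x_1,\dots,x_m\in S^2$ and weights $w_1,\dots,w_m>0$, that have the Marcinkiewicz–Zygmund property $$(1-\eta)\int_{S^2}\chi^2\,d\omega\le\sum_{j=1}^m w_j\chi(x_j)^2\le(1+\eta)\int_{S^2}\chi^2\,d\omega\qquad\text{for all }\chi\in\mathbb P_n .$$ The hyperinterpolation of $g\in C(S^2)$ is $\mathcal L_n g=\sum_{\ell=0}^n\sum_{k=1}^{2\ell+1}\big(\sum_{j=1}^m w_j g(x_j)Y_{\ell,k}(x_j)\big)Y_{\ell,k}$. With $$W_j(x)=w_j\sum_{\ell=0}^n\sum_{k=1}^{2\ell+1}\Big(\int_{S^2}h(|x-y|)Y_{\ell,k}(y)\,d\omega(y)\Big)Y_{\ell,k}(x_j),$$ the scheme first solves the linear system $$v_i-\sum_{j=1}^mW_j(x_i)K(x_i,x_j)v_j=f(x_i),\qquad i=1,\dots,m,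 \tag{2}$$ and then sets $$\varphi_\gamma(t)=f(t)+\sum_{j=1}^mW_j(t)K(t,x_j)v_j,\qquad t\in S^2. \tag{3}$$ **Theorem.** For every $f\in C(S^2)$, equation (1) has exactly one solution $\varphi\in C(S^2)$. There are $N\in\mathbb N$, $\eta_0>0$ and positive constants $C_1(n,\eta)$, $C_2(n,\eta)$, strictly decreasing as $n$ grows or as $\eta$ decreases in $[0,1)$, and not depending on $f$, on $m$ or on the points and weights, such that the following holds for every $\gamma\in\Gamma$ with $n\ge N$ and $\eta\le\eta_0$ and every $f\in C(S^2)$, with $\varphi$ the solution of (1). * The system (2) has exactly one solution, the function $\varphi_\gamma$ of (3) is continuous, and it satisfies $$\varphi_\gamma(x)-\int_{S^2}h(|x-y|)\,\mathcal L_n\big(K(x,\cdot)\varphi_\gamma\big)(y)\,d\omega(y)=f(x),\qquad x\in S^2 .$$ * $\|\varphi_\gamma\|_\infty\le C_1(n,\eta)\|f\|_\infty$. * There is $x_0\in S^2$ such that $K(x_0,\cdot)\varphi$ has a best approximation in $\mathbb P_n$ and, for every such best approximation $\chi^*$, $$\|\varphi_\gamma-\varphi\|_\infty\le C_2(n,\eta)\Big(E_n\big(K(x_0,\cdot)\varphi\big)+\sqrt{\eta^2+4\eta}\,\|\chi^*\|_{L^2(S^2)}\Big).$$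 Moreover, for each $f\in C(S^2)$, $\varphi_\gamma\to\varphi$ uniformly as $n\to\infty$ and $\eta\to0$ simultaneously: for every $\varepsilon>0$ there are $N'\in\mathbb N$ and $\delta>0$ such that for every $\gamma\in\Gamma$ with $n\ge N'$ and $\eta\le\delta$ the function $\varphi_\gamma$ is uniquely determined by (2)–(3) and $\|\varphi_\gamma-\varphi\|_\infty<\varepsilon$. -/

import Mathlib

open MeasureTheory Set

/-- The unit sphere `S²` in Euclidean `ℝ³`; `dist x y` on it is the Euclidean distance `|x - y|`. -/
abbrev S2 : Type := Metric.sphere (0 : EuclideanSpace ℝ (Fin 3)) 1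

/-- The surface measure `ω` on `S²` (total mass `4π`). -/
noncomputable abbrev surf : Measure S2 :=
  (volume : Measure (EuclideanSpace ℝ (Fin 3))).toSphere

/-- The space of real spherical harmonics of degree `ℓ`: restrictions to `S²` of harmonic
homogeneous polynomials of degree `ℓ` in three variables. -/
noncomputable def sphHarmonics (ℓ : ℕ) : Submodule ℝ C(S2, ℝ) where
  carrier := {g | ∃ p : MvPolynomial (Fin 3) ℝ, p.IsHomogeneous ℓ ∧
    (∑ i, MvPolynomial.pderiv i (MvPolynomial.pderiv i p)) = 0 ∧
    ∀ x : S2, g x = MvPolynomial.eval (fun i => x.1 i) p}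
  zero_mem' := ⟨0, MvPolynomial.isHomogeneous_zero _ _ _, by simp, by simp⟩
  add_mem' := by
    rintro a b ⟨p, hp, hp', hpa⟩ ⟨q, hq, hq', hqb⟩
    refine ⟨p + q, hp.add hq, ?_, fun x => by simp [hpa, hqb]⟩
    simp only [map_add, Finset.sum_add_distrib, hp', hq', add_zero]
  smul_mem' := by
    rintro c a ⟨p, hp, hp', hpa⟩
    refine ⟨c • p, (MvPolynomial.homogeneousSubmodule (Fin 3) ℝ ℓ).smul_mem c hp, ?_,
      fun x => by simp [hpa, MvPolynomial.smul_eval]⟩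
    have e : ∀ i, MvPolynomial.pderiv i (MvPolynomial.pderiv i (c • p)) =
        c • MvPolynomial.pderiv i (MvPolynomial.pderiv i p) := fun i => by
      rw [Derivation.map_smul, Derivation.map_smul]
    simp only [e, ← Finset.smul_sum, hp', smul_zero]

/-- `ℙ_n`, the span of the spherical harmonics of degree at most `n`. -/
noncomputable def sphPoly (n : ℕ) : Submodule ℝ C(S2, ℝ) :=
  ⨆ ℓ ∈ Finset.range (n + 1), sphHarmonics ℓ

/-- `Y ℓ k` (`ℓ ≥ 0`, `2ℓ + 1` values of `k`) is an `L²(S²)`-orthonormal system of real spherical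
harmonics: for each `ℓ` the functions `Y ℓ k` form a basis of the harmonics of degree `ℓ`. -/
structure IsSphHarmonicSystem (Y : (ℓ : ℕ) → Fin (2 * ℓ + 1) → C(S2, ℝ)) : Prop where
  span_eq : ∀ ℓ, Submodule.span ℝ (Set.range (Y ℓ)) = sphHarmonics ℓ
  norm_one : ∀ ℓ k, ∫ y, Y ℓ k y * Y ℓ k y ∂surf = 1
  orthogonal : ∀ p q : (Σ ℓ : ℕ, Fin (2 * ℓ + 1)), p ≠ q →
    ∫ y, Y p.1 p.2 y * Y q.1 q.2 y ∂surf = 0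

/-- A quadrature rule on `S²` with `m` distinct nodes and positive weights. -/
structure SphQuadrature (m : ℕ) where
  node : Fin m → S2
  weight : Fin m → ℝ
  node_injective : Function.Injective node
  weight_pos : ∀ j, 0 < weight j

/-- The Marcinkiewicz–Zygmund property of degree `n` with constant `η ∈ [0,1)`;
equivalently `(m, n, η) ∈ Γ`. -/
def SphQuadrature.IsMZ {m : ℕ} (Q : SphQuadrature m) (n : ℕ) (η : ℝ) : Prop :=
  0 ≤ η ∧ η < 1 ∧ ∀ χ ∈ sphPoly n,
    (1 - η) * ∫ y, χ y ^ 2 ∂surf ≤ ∑ j, Q.weight j * χ (Q.node j) ^ 2 ∧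
    ∑ j, Q.weight j * χ (Q.node j) ^ 2 ≤ (1 + η) * ∫ y, χ y ^ 2 ∂surf

/-- The hyperinterpolation `𝓛_n g` of degree `n` of a continuous function `g`. -/
noncomputable def hyperinterp (Y : (ℓ : ℕ) → Fin (2 * ℓ + 1) → C(S2, ℝ)) {m : ℕ}
    (Q : SphQuadrature m) (n : ℕ) (g : C(S2, ℝ)) : C(S2, ℝ) :=
  ∑ ℓ ∈ Finset.range (n + 1), ∑ k : Fin (2 * ℓ + 1),
    (∑ j, Q.weight j * g (Q.node j) * Y ℓ k (Q.node j)) • Y ℓ k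

/-- Weak singularity of `h` on the range `(0, 2]` of distances between distinct points of `S²`. -/
def IsWeaklySingular (h : ℝ → ℝ) : Prop :=
  ContinuousOn h (Ioc 0 2) ∧ ∃ M α : ℝ, 0 < M ∧ 0 < α ∧ α ≤ 2 ∧
    ∀ r ∈ Ioc (0 : ℝ) 2, |h r| ≤ M * r ^ (α - 2)

/-- The continuous function `y ↦ K(x, y) φ(y)`. -/
def kernelMul (K : C(S2 × S2, ℝ)) (x : S2) (φ : C(S2, ℝ)) : C(S2, ℝ) :=
  K.curry x * φ

/-- `φ(x) - ∫ h(|x-y|) K(x,y) φ(y) dω(y) = f(x)` for all `x ∈ S²`. -/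
def IsExactSolution (h : ℝ → ℝ) (K : C(S2 × S2, ℝ)) (f φ : C(S2, ℝ)) : Prop :=
  ∀ x : S2, φ x - ∫ y, h (dist x y) * K (x, y) * φ y ∂surf = f x

/-- The weight functions `W_j(x) = w_j ∑_{ℓ ≤ n} ∑_k (∫ h(|x-y|) Y_{ℓ,k}(y) dω(y)) Y_{ℓ,k}(x_j)`. -/
noncomputable def productWeight (h : ℝ → ℝ) (Y : (ℓ : ℕ) → Fin (2 * ℓ + 1) → C(S2, ℝ)) {m : ℕ}
    (Q : SphQuadrature m) (n : ℕ) (j : Fin m) (x : S2) : ℝ :=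
  Q.weight j * ∑ ℓ ∈ Finset.range (n + 1), ∑ k : Fin (2 * ℓ + 1),
    (∫ y, h (dist x y) * Y ℓ k y ∂surf) * Y ℓ k (Q.node j)

/-- Stage one: `v` solves the `m × m` linear system for the values at the nodes. -/
def SolvesNodalSystem (h : ℝ → ℝ) (K : C(S2 × S2, ℝ)) (f : C(S2, ℝ))
    (Y : (ℓ : ℕ) → Fin (2 * ℓ + 1) → C(S2, ℝ)) {m : ℕ} (Q : SphQuadrature m) (n : ℕ)
    (v : Fin m → ℝ) : Prop :=
  ∀ i, v i - ∑ j, productWeight h Y Q n j (Q.node i) * K (Q.node i, Q.node j) * v j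
    = f (Q.node i)

/-- `ψ` is computed by the two-stage scheme: solve the nodal system, then evaluate. -/
def IsSchemeSolution (h : ℝ → ℝ) (K : C(S2 × S2, ℝ)) (f : C(S2, ℝ))
    (Y : (ℓ : ℕ) → Fin (2 * ℓ + 1) → C(S2, ℝ)) {m : ℕ} (Q : SphQuadrature m) (n : ℕ)
    (ψ : C(S2, ℝ)) : Prop :=
  ∃ v : Fin m → ℝ, SolvesNodalSystem h K f Y Q n v ∧
    ∀ t : S2, ψ t = f t + ∑ j, productWeight h Y Q n j t * K (t, Q.node j) * v j

/-- `E_n(g)`, the error of best uniform approximation of `g` from `ℙ_n`. -/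
noncomputable def bestError (n : ℕ) (g : C(S2, ℝ)) : ℝ :=
  ⨅ χ : sphPoly n, ‖g - (χ : C(S2, ℝ))‖

/-- `χ` is a best uniform approximation of `g` in `ℙ_n` (it need not be unique). -/
def IsBestApprox (n : ℕ) (g χ : C(S2, ℝ)) : Prop :=
  χ ∈ sphPoly n ∧ ‖g - χ‖ = bestError n g

/-- The norm of `L²(S²)` on continuous functions. -/
noncomputable def sphL2Norm (g : C(S2, ℝ)) : ℝ := Real.sqrt (∫ y, g y ^ 2 ∂surf)

/-- A positive constant `C(n, η)`, `η ∈ [0,1)`, that decreases as `n` grows or `η` decreases. -/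
structure IsDecreasingConstant (C : ℕ → ℝ → ℝ) : Prop where
  pos : ∀ n, ∀ η ∈ Ico (0 : ℝ) 1, 0 < C n η
  anti : ∀ η ∈ Ico (0 : ℝ) 1, StrictAnti fun n => C n η
  mono : ∀ n, StrictMonoOn (C n) (Ico 0 1)

/-!
Write `H x = h(|x - ·|)` as an element of `L²(S²)`. Since `|x - y| = √(2(1 - x·y))` and, by
Archimedes' theorem (`measurePreserving_inner_surf`), `y ↦ x·y` carries the surface measure to `2π`
times Lebesgue measure on `(-1, 1)`, square integrability of `t ↦ h(√(2(1 - t)))` says precisely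
that `H x` is in `L²`, and composition with measure preserving maps depends continuously on the
map, so `H : S² → L²(S²)` is continuous (`exists_continuous_zonal`).

The exact integral operator and that of the scheme then have the same shape
`φ ↦ (x ↦ ⟪H x, L (K(x, ·) φ)⟫)` (`kernelOp`), with `L` the inclusion `C(S²) → L²(S²)` in the first
case and hyperinterpolation `𝓛_n` in the second. All operators of this shape with `‖L‖ ≤ B` map the
unit ball into one compact set (`exists_isCompact_kernelOp_mem`). The Marcinkiewicz–Zygmund
inequalities bound `𝓛_n : C(S²) → L²(S²)` uniformly and give
`‖𝓛_n χ - χ‖ ≤ √(η² + 4η) ‖χ‖` on `ℙ_n` (`IsSphHarmonicSystem.norm_hyperinterp_sub_self_le`), so the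
operators of the scheme converge pointwise as `n → ∞`, `η → 0` (`tendsto_schemeOp`); here the union
of the `ℙ_n` is dense because `ℙ_n` has the dimension `(n + 1)²` of all polynomials of degree at
most `n` on the sphere (`IsSphHarmonicSystem.sphPoly_eq`), and Stone–Weierstrass applies.

Pointwise convergence, collective compactness and injectivity of the limit equation give a uniform
lower bound for `1 - A_γ` (`eventually_norm_le_mul_norm_sub`). With the Fredholm alternative this
yields solvability and stability, and `‖φ_γ - φ‖ ≤ c ‖A_γ φ - A φ‖` reduces the error estimate to
the `L²` error of hyperinterpolation at a point `x₀` where `|A_γ φ - A φ|` is largest.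
-/

/-! ### Archimedes' theorem on zonal functions -/

theorem measurableSet_lt_one_and_mem {α : Type*} [MeasurableSpace α] {f g : α → ℝ}
    (hf : Measurable f) (hg : Measurable g) {T : Set ℝ} (hT : MeasurableSet T) :
    MeasurableSet {a | f a < 1 ∧ g a ∈ T} :=
  (measurableSet_lt hf measurable_const).inter (hg hT)

theorem sqrt_sq_add_sq_polar {r : ℝ} (hr : 0 < r) (θ : ℝ) :
    Real.sqrt ((r * Real.cos θ) ^ 2 + (r * Real.sin θ) ^ 2) = r := by
  rw [show (r * Real.cos θ) ^ 2 + (r * Real.sin θ) ^ 2 = r ^ 2 by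
    linear_combination r ^ 2 * Real.sin_sq_add_cos_sq θ, Real.sqrt_sq hr.le]

/-- The integral over the plane of a radial function. -/
theorem lintegral_comp_sqrt_sq_add_sq {F : ℝ → ENNReal} (hF : Measurable F) :
    ∫⁻ p : ℝ × ℝ, F (Real.sqrt (p.1 ^ 2 + p.2 ^ 2)) =
      ENNReal.ofReal (2 * Real.pi) * ∫⁻ r in Ioi (0 : ℝ), ENNReal.ofReal r * F r := by
  have hA : Measurable fun r : ℝ => ENNReal.ofReal r * F r := by fun_prop
  rw [← lintegral_comp_polarCoord_symm, polarCoord_target,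
    setLIntegral_congr_fun (g := fun p : ℝ × ℝ => (ENNReal.ofReal p.1 * F p.1) * 1)
      (measurableSet_Ioi.prod measurableSet_Ioo),
    Measure.volume_eq_prod, ← Measure.prod_restrict,
    lintegral_prod_mul (f := fun r => ENNReal.ofReal r * F r) (g := fun _ => 1)
      hA.aemeasurable aemeasurable_const]
  · rw [mul_comm]
    congr 1
    simp only [lintegral_const, one_mul, Measure.restrict_apply_univ, Real.volume_Ioo]
    congr 1; ring
  · rintro ⟨r, θ⟩ ⟨hr, -⟩
    have h0 := sqrt_sq_add_sq_polar hr θ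
    simp only [polarCoord_symm_apply, smul_eq_mul, mul_one, h0]

/-- The substitution `t = cos θ`, for the indicator of `T`. -/
theorem lintegral_indicator_sin {T : Set ℝ} (hT : MeasurableSet T) :
    ∫⁻ θ in Ioo 0 Real.pi, (Real.cos ⁻¹' T).indicator (fun θ => ENNReal.ofReal (Real.sin θ)) θ =
      volume (T ∩ Ioo (-1) 1) := by
  have himg : Real.cos '' Ioo 0 Real.pi = Ioo (-1) 1 := by
    apply Subset.antisymm
    · rintro _ ⟨θ, hθ, rfl⟩
      have h1 := Real.strictAntiOn_cos (left_mem_Icc.2 Real.pi_pos.le) (Ioo_subset_Icc_self hθ) hθ.1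
      have h2 := Real.strictAntiOn_cos (Ioo_subset_Icc_self hθ) (right_mem_Icc.2 Real.pi_pos.le)
        hθ.2
      rw [Real.cos_zero] at h1
      rw [Real.cos_pi] at h2
      exact ⟨h2, h1⟩
    · intro t ht
      refine ⟨Real.arccos t, ⟨Real.arccos_pos.2 ht.2, ?_⟩, Real.cos_arccos ht.1.le ht.2.le⟩
      refine lt_of_le_of_ne (Real.arccos_le_pi t) fun h => ?_
      rw [Real.arccos_eq_pi] at h
      exact absurd ht.1 h.not_gt
  have key := lintegral_image_eq_lintegral_abs_deriv_mul (f := Real.cos)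
    (f' := fun θ => -Real.sin θ) (s := Ioo 0 Real.pi) measurableSet_Ioo
    (fun θ _ => (Real.hasDerivAt_cos θ).hasDerivWithinAt)
    (Real.strictAntiOn_cos.injOn.mono Ioo_subset_Icc_self) (T.indicator 1)
  rw [himg, lintegral_indicator_one hT, Measure.restrict_apply hT] at key
  rw [key]
  refine setLIntegral_congr_fun measurableSet_Ioo fun θ hθ => ?_
  have hs := Real.sin_pos_of_mem_Ioo hθ
  by_cases h : Real.cos θ ∈ T <;> simp [indicator, h, abs_of_pos hs]

theorem lintegral_sq_Ioo :
    ∫⁻ r in Ioi (0 : ℝ), (Iio 1).indicator (fun r => ENNReal.ofReal (r ^ 2)) r =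
      ENNReal.ofReal (1 / 3) := by
  rw [lintegral_indicator measurableSet_Iio, Measure.restrict_restrict measurableSet_Iio,
    inter_comm, Ioi_inter_Iio, restrict_Ioo_eq_restrict_Ioc,
    ← ofReal_integral_eq_lintegral_ofReal (by
      exact (intervalIntegral.intervalIntegrable_pow 2).1)
      (Filter.Eventually.of_forall fun r => sq_nonneg r),
    ← intervalIntegral.integral_of_le zero_le_one, integral_pow]
  norm_num

/-- The volume of the solid of revolution `{‖z‖ < 1, z₀ / ‖z‖ ∈ T}`, up to the factor `2π` of the
turn, computed in polar coordinates `u = s cos θ`, `r = s sin θ` of the half plane `r > 0`. -/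
theorem lintegral_half_plane_cone {T : Set ℝ} (hT : MeasurableSet T) :
    ∫⁻ r in Ioi (0 : ℝ), ENNReal.ofReal r *
        volume {u : ℝ | Real.sqrt (u ^ 2 + r ^ 2) < 1 ∧ u / Real.sqrt (u ^ 2 + r ^ 2) ∈ T} =
      ENNReal.ofReal (1 / 3) * volume (T ∩ Ioo (-1) 1) := by
  let S : Set (ℝ × ℝ) := {p | 0 < p.2 ∧ Real.sqrt (p.1 ^ 2 + p.2 ^ 2) < 1 ∧
    p.1 / Real.sqrt (p.1 ^ 2 + p.2 ^ 2) ∈ T}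
  have hS : MeasurableSet S :=
    (measurableSet_lt measurable_const measurable_snd).inter
      (measurableSet_lt_one_and_mem (by fun_prop) (by fun_prop) hT)
  let G : ℝ × ℝ → ENNReal := S.indicator fun p => ENNReal.ofReal p.2
  have hG : Measurable G := (by fun_prop : Measurable fun p : ℝ × ℝ =>
    ENNReal.ofReal p.2).indicator hS
  have h1 : ∫⁻ p, G p = ∫⁻ r in Ioi (0 : ℝ), ENNReal.ofReal r *
        volume {u : ℝ | Real.sqrt (u ^ 2 + r ^ 2) < 1 ∧ u / Real.sqrt (u ^ 2 + r ^ 2) ∈ T} := by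
    rw [Measure.volume_eq_prod, lintegral_prod_symm _ hG.aemeasurable,
      ← lintegral_indicator measurableSet_Ioi]
    refine lintegral_congr fun r => ?_
    by_cases hr : 0 < r
    · have hm : MeasurableSet
          {u : ℝ | Real.sqrt (u ^ 2 + r ^ 2) < 1 ∧ u / Real.sqrt (u ^ 2 + r ^ 2) ∈ T} :=
        measurableSet_lt_one_and_mem (by fun_prop) (by fun_prop) hT
      rw [indicator_of_mem (mem_Ioi.2 hr), ← lintegral_indicator_const hm]
      refine lintegral_congr fun u => ?_
      by_cases hu : u ∈ {u : ℝ | Real.sqrt (u ^ 2 + r ^ 2) < 1 ∧ u / Real.sqrt (u ^ 2 + r ^ 2) ∈ T}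
      · rw [indicator_of_mem hu]
        exact indicator_of_mem (s := S) (a := (u, r)) ⟨hr, hu⟩ _
      · rw [indicator_of_notMem hu]
        exact indicator_of_notMem (s := S) (a := (u, r)) (fun h => hu h.2) _
    · rw [indicator_of_notMem (by simpa using hr)]
      simp [G, S, hr]
  have hA : Measurable ((Iio (1 : ℝ)).indicator fun r => ENNReal.ofReal (r ^ 2)) :=
    (by fun_prop : Measurable fun r : ℝ => ENNReal.ofReal (r ^ 2)).indicator measurableSet_Iio
  have hB0 : Measurable ((Real.cos ⁻¹' T).indicator fun θ => ENNReal.ofReal (Real.sin θ)) :=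
    (by fun_prop : Measurable fun r : ℝ => ENNReal.ofReal (Real.sin r)).indicator
      (Real.measurable_cos hT)
  have hB : Measurable ((Ioi (0 : ℝ)).indicator
      ((Real.cos ⁻¹' T).indicator fun θ => ENNReal.ofReal (Real.sin θ))) :=
    hB0.indicator measurableSet_Ioi
  rw [← h1, ← lintegral_comp_polarCoord_symm, polarCoord_target,
    setLIntegral_congr_fun (g := fun p : ℝ × ℝ =>
      ((Iio (1 : ℝ)).indicator fun r => ENNReal.ofReal (r ^ 2)) p.1 *
      ((Ioi (0 : ℝ)).indicator
        ((Real.cos ⁻¹' T).indicator fun θ => ENNReal.ofReal (Real.sin θ))) p.2)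
      (measurableSet_Ioi.prod measurableSet_Ioo),
    Measure.volume_eq_prod, ← Measure.prod_restrict,
    lintegral_prod_mul hA.aemeasurable hB.aemeasurable, lintegral_sq_Ioo,
    lintegral_indicator measurableSet_Ioi, Measure.restrict_restrict measurableSet_Ioi,
    ← lintegral_indicator_sin hT]
  · congr 3
    ext θ
    simp only [mem_inter_iff, mem_Ioi, mem_Ioo]
    exact ⟨fun h => ⟨h.1, h.2.2⟩, fun h => ⟨h.1, by linarith [Real.pi_pos, h.1], h.2⟩⟩
  · rintro ⟨r, θ⟩ ⟨hr, hθ⟩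
    have hr : 0 < r := hr
    have hθ : -Real.pi < θ ∧ θ < Real.pi := hθ
    have h0 := sqrt_sq_add_sq_polar hr θ
    have hsin : 0 < Real.sin θ ↔ 0 < θ := by
      refine ⟨fun h => ?_, fun h => Real.sin_pos_of_pos_of_lt_pi h hθ.2⟩
      by_contra! hc
      exact absurd h (Real.sin_nonpos_of_nonpos_of_neg_pi_le hc hθ.1.le).not_gt
    have hmem : (r * Real.cos θ, r * Real.sin θ) ∈ S ↔ 0 < θ ∧ r < 1 ∧ Real.cos θ ∈ T := by
      simp only [S, mem_ofPred_eq, h0, mul_pos_iff_of_pos_left hr, hsin,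
        mul_div_cancel_left₀ _ hr.ne']
    simp only [polarCoord_symm_apply, smul_eq_mul, G]
    by_cases h : 0 < θ ∧ r < 1 ∧ Real.cos θ ∈ T
    · rw [indicator_of_mem (hmem.2 h), indicator_of_mem (mem_Iio.2 h.2.1),
        indicator_of_mem (mem_Ioi.2 h.1), indicator_of_mem (s := Real.cos ⁻¹' T) h.2.2,
        ← ENNReal.ofReal_mul hr.le, ← ENNReal.ofReal_mul (by positivity)]
      congr 1; ring
    · rw [indicator_of_notMem (fun h' => h (hmem.1 h')), mul_zero]
      by_cases h1 : 0 < θ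
      · by_cases h2 : r < 1
        · rw [indicator_of_mem (mem_Ioi.2 h1), indicator_of_notMem (s := Real.cos ⁻¹' T)
            (fun h3 => h ⟨h1, h2, h3⟩), mul_zero]
        · rw [indicator_of_notMem (s := Iio (1 : ℝ)) h2, zero_mul]
      · rw [indicator_of_notMem (s := Ioi (0 : ℝ)) h1, mul_zero]

theorem volume_cone {T : Set ℝ} (hT : MeasurableSet T) :
    volume {z : EuclideanSpace ℝ (Fin 3) | ‖z‖ < 1 ∧ z 0 / ‖z‖ ∈ T} =
      ENNReal.ofReal (2 * Real.pi / 3) * volume (T ∩ Ioo (-1) 1) := by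
  have e1 := EuclideanSpace.volume_preserving_symm_measurableEquiv_toLp (Fin 3)
  have e2 := volume_preserving_piFinSuccAbove (fun _ : Fin 3 => ℝ) 0
  have e3 := (MeasurePreserving.id (volume : Measure ℝ)).prod (volume_preserving_finTwoArrow ℝ)
  have e := e3.comp (e2.comp e1)
  let S : Set (ℝ × ℝ × ℝ) := {p | Real.sqrt (p.1 ^ 2 + Real.sqrt (p.2.1 ^ 2 + p.2.2 ^ 2) ^ 2) < 1 ∧
    p.1 / Real.sqrt (p.1 ^ 2 + Real.sqrt (p.2.1 ^ 2 + p.2.2 ^ 2) ^ 2) ∈ T}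
  have hS : MeasurableSet S :=
    measurableSet_lt_one_and_mem (by fun_prop) (by fun_prop) hT
  let R : Set (ℝ × ℝ) := {p | Real.sqrt (p.1 ^ 2 + p.2 ^ 2) < 1 ∧
    p.1 / Real.sqrt (p.1 ^ 2 + p.2 ^ 2) ∈ T}
  have hR : MeasurableSet R :=
    measurableSet_lt_one_and_mem (by fun_prop) (by fun_prop) hT
  have hpre : {z : EuclideanSpace ℝ (Fin 3) | ‖z‖ < 1 ∧ z 0 / ‖z‖ ∈ T} =
      (Prod.map id (MeasurableEquiv.finTwoArrow) ∘
        MeasurableEquiv.piFinSuccAbove (fun _ : Fin 3 => ℝ) 0 ∘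
        (MeasurableEquiv.toLp 2 (Fin 3 → ℝ)).symm) ⁻¹' S := by
    ext z
    have : ‖z‖ = Real.sqrt (z 0 ^ 2 + Real.sqrt (z 1 ^ 2 + z 2 ^ 2) ^ 2) := by
      rw [EuclideanSpace.norm_eq, Real.sq_sqrt (by positivity), Fin.sum_univ_three]
      simp [add_assoc]
    simp only [mem_ofPred_eq, this]
    rfl
  -- Slice by the coordinate along the axis; what is left depends on the distance to the axis only.
  rw [hpre, e.measure_preimage hS.nullMeasurableSet, Measure.volume_eq_prod,
    Measure.prod_apply_symm hS]
  have := lintegral_comp_sqrt_sq_add_sq (measurable_measure_prodMk_right (μ := volume) hR)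
  refine this.trans ?_
  have h2 := lintegral_half_plane_cone hT
  refine (congrArg _ h2).trans ?_
  rw [← mul_assoc, ← ENNReal.ofReal_mul (by positivity)]
  congr 2; ring

theorem volume_cone_about {x : EuclideanSpace ℝ (Fin 3)} (hx : ‖x‖ = 1) {T : Set ℝ}
    (hT : MeasurableSet T) :
    volume {z : EuclideanSpace ℝ (Fin 3) | ‖z‖ < 1 ∧ inner ℝ x z / ‖z‖ ∈ T} =
      ENNReal.ofReal (2 * Real.pi / 3) * volume (T ∩ Ioo (-1) 1) := by
  have ho : Orthonormal ℝ (({0} : Set (Fin 3)).domRestrict (fun _ => x)) := by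
    constructor
    · intro i; exact hx
    · intro i j hij; exact absurd (Subsingleton.elim i j) hij
  obtain ⟨b, hb⟩ := Orthonormal.exists_orthonormalBasis_extension_of_card_eq (ι := Fin 3)
    (by simp) ho
  have hb0 : b 0 = x := hb 0 rfl
  have hS : MeasurableSet {z : EuclideanSpace ℝ (Fin 3) | ‖z‖ < 1 ∧ z 0 / ‖z‖ ∈ T} :=
    measurableSet_lt_one_and_mem (by fun_prop) (by fun_prop) hT
  rw [← volume_cone hT, ← b.repr.measurePreserving.measure_preimage hS.nullMeasurableSet]
  congr 1
  ext z
  simp [← hb0, b.repr_apply_apply]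

open scoped Pointwise in
/-- **Archimedes' theorem**: orthogonal projection of the sphere to an axis carries the surface
measure to `2π` times Lebesgue measure. -/
theorem measurePreserving_inner_surf (x : S2) :
    MeasurePreserving (fun y : S2 => inner ℝ x.1 y.1) surf
      (ENNReal.ofReal (2 * Real.pi) • volume.restrict (Ioo (-1 : ℝ) 1)) := by
  have hm : Measurable (fun y : S2 => inner ℝ x.1 y.1) := by fun_prop
  refine ⟨hm, ?_⟩
  ext T hT
  rw [Measure.map_apply hm hT, Measure.toSphere_apply' _ (hm hT)]
  have : Ioo (0 : ℝ) 1 • (Subtype.val '' ((fun y : S2 => inner ℝ x.1 y.1) ⁻¹' T)) =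
      {z : EuclideanSpace ℝ (Fin 3) | ‖z‖ < 1 ∧ inner ℝ x.1 z / ‖z‖ ∈ T} \ {0} := by
    ext z
    simp only [Set.mem_smul, mem_image, mem_preimage, mem_sdiff, mem_ofPred_eq, mem_singleton_iff]
    constructor
    · rintro ⟨r, hr, _, ⟨y, hy, rfl⟩, rfl⟩
      have hy1 : ‖y.1‖ = 1 := by simp
      have hr0 : r ≠ 0 := hr.1.ne'
      refine ⟨⟨?_, ?_⟩, ?_⟩
      · rw [norm_smul, hy1, mul_one, Real.norm_of_nonneg hr.1.le]; exact hr.2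
      · rw [norm_smul, hy1, mul_one, Real.norm_of_nonneg hr.1.le, inner_smul_right,
          mul_div_cancel_left₀ _ hr0]
        exact hy
      · intro h0
        rcases smul_eq_zero.1 h0 with h | h
        · exact hr0 h
        · simp [h] at hy1
    · rintro ⟨⟨h1, h2⟩, h0⟩
      have hz : 0 < ‖z‖ := norm_pos_iff.2 h0
      refine ⟨‖z‖, ⟨hz, h1⟩, ‖z‖⁻¹ • z, ⟨⟨‖z‖⁻¹ • z, ?_⟩, ?_, rfl⟩, ?_⟩
      · simp [norm_smul, hz.ne']
      · simpa [inner_smul_right, inv_mul_eq_div] using h2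
      · rw [smul_smul, mul_inv_cancel₀ hz.ne', one_smul]
  rw [this, measure_sdiff_null (measure_singleton _), volume_cone_about (by simp) hT,
    Measure.smul_apply, Measure.restrict_apply hT, smul_eq_mul, ← mul_assoc]
  congr 1
  rw [finrank_euclideanSpace_fin, Nat.cast_ofNat, show (3 : ENNReal) = ENNReal.ofReal 3 by simp,
    ← ENNReal.ofReal_mul (by norm_num)]
  congr 1; ring

/-! ### The kernel as a continuous family in `L²(S²)` -/

theorem dist_eq_sqrt_inner (x y : S2) : dist x y = Real.sqrt (2 * (1 - inner ℝ x.1 y.1)) := by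
  rw [Subtype.dist_eq, dist_eq_norm, ← Real.sqrt_sq (norm_nonneg _), norm_sub_sq_real]
  congr 1
  simp
  ring

/-- The space `L²(S²)`. -/
abbrev SphL2 : Type := Lp ℝ 2 surf

/-- The inclusion of the continuous functions into `L²(S²)`. -/
noncomputable abbrev toSphL2 : C(S2, ℝ) →L[ℝ] SphL2 := ContinuousMap.toLp 2 surf ℝ

theorem memLp_zonal {h : ℝ → ℝ}
    (hL2 : MemLp (fun t : ℝ => h (Real.sqrt (2 * (1 - t)))) 2 (volume.restrict (Ioo (-1) 1))) :
    MemLp (fun t : ℝ => h (Real.sqrt (2 * (1 - t)))) 2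
      (ENNReal.ofReal (2 * Real.pi) • volume.restrict (Ioo (-1 : ℝ) 1)) :=
  hL2.smul_measure ENNReal.ofReal_ne_top

/-- The functions `h(|x - ·|)` form a continuous family in `L²(S²)`: they are the compositions of
one square integrable function with the measure preserving maps `y ↦ x·y`. -/
theorem exists_continuous_zonal {h : ℝ → ℝ}
    (hL2 : MemLp (fun t : ℝ => h (Real.sqrt (2 * (1 - t)))) 2 (volume.restrict (Ioo (-1) 1))) :
    ∃ H : C(S2, SphL2), ∀ x, H x =ᵐ[surf] fun y => h (dist x y) := by
  let F : S2 → C(S2, ℝ) := fun x => ⟨fun y => inner ℝ x.1 y.1, by fun_prop⟩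
  have hF : Continuous F := by
    refine ContinuousMap.continuous_of_continuous_uncurry _ ?_
    change Continuous fun p : S2 × S2 => inner ℝ p.1.1 p.2.1
    fun_prop
  have hmp : ∀ x, MeasurePreserving (F x) surf
      (ENNReal.ofReal (2 * Real.pi) • volume.restrict (Ioo (-1 : ℝ) 1)) := measurePreserving_inner_surf
  have : IsFiniteMeasure (ENNReal.ofReal (2 * Real.pi) • volume.restrict (Ioo (-1 : ℝ) 1)) :=
    Measure.smul_finite _ ENNReal.ofReal_ne_top
  refine ⟨⟨fun x => Lp.compMeasurePreserving (F x) (hmp x) ((memLp_zonal hL2).toLp _),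
    continuous_const.compMeasurePreservingLp hF hmp (by norm_num)⟩, fun x => ?_⟩
  change (Lp.compMeasurePreserving (F x) (hmp x) ((memLp_zonal hL2).toLp _) : S2 → ℝ) =ᵐ[surf] _
  rw [Lp.toLp_compMeasurePreserving]
  filter_upwards [MemLp.coeFn_toLp ((memLp_zonal hL2).comp_measurePreserving (hmp x))] with y hy
  rw [hy, dist_eq_sqrt_inner]
  rfl

theorem inner_toSphL2 {v : SphL2} {u : S2 → ℝ} (hv : v =ᵐ[surf] u) (g : C(S2, ℝ)) :
    inner ℝ v (toSphL2 g) = ∫ y, u y * g y ∂surf := by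
  rw [L2.inner_def]
  refine integral_congr_ae ?_
  filter_upwards [hv, ContinuousMap.coeFn_toLp (p := 2) (𝕜 := ℝ) surf g] with y h1 h2
  rw [h1, h2]
  simp [mul_comm]

theorem inner_toSphL2_toSphL2 (f g : C(S2, ℝ)) :
    inner ℝ (toSphL2 f) (toSphL2 g) = ∫ y, f y * g y ∂surf :=
  inner_toSphL2 (ContinuousMap.coeFn_toLp (p := 2) (𝕜 := ℝ) surf f) g

theorem norm_toSphL2_sq (f : C(S2, ℝ)) : ‖toSphL2 f‖ ^ 2 = ∫ y, f y ^ 2 ∂surf := by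
  rw [← real_inner_self_eq_norm_sq, inner_toSphL2_toSphL2]
  simp only [sq]

theorem norm_toSphL2 (f : C(S2, ℝ)) : ‖toSphL2 f‖ = sphL2Norm f := by
  rw [sphL2Norm, ← norm_toSphL2_sq, Real.sqrt_sq (norm_nonneg _)]

theorem norm_toSphL2_le (f : C(S2, ℝ)) :
    ‖toSphL2 f‖ ≤ Real.sqrt (surf.real univ) * ‖f‖ := by
  rw [norm_toSphL2, sphL2Norm]
  refine Real.sqrt_le_iff.2 ⟨by positivity, ?_⟩
  rw [mul_pow, Real.sq_sqrt measureReal_nonneg]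
  have hi : Integrable (fun y => f y ^ 2) surf :=
    (f ^ 2).continuous.integrable_of_hasCompactSupport (.of_compactSpace _)
  calc ∫ y, f y ^ 2 ∂surf ≤ ∫ _, ‖f‖ ^ 2 ∂surf :=
        integral_mono hi (integrable_const _) fun y =>
          sq_le_sq.2 (by simpa [abs_of_nonneg] using f.norm_coe_le_norm y)
    _ = _ := by simp

/-! ### Collectively compact integral operators -/

section KernelOperator

variable {X V : Type*} [MetricSpace X] [CompactSpace X]
  [NormedAddCommGroup V] [InnerProductSpace ℝ V]

theorem norm_curry_le (K : C(X × X, ℝ)) (x : X) : ‖K.curry x‖ ≤ ‖K‖ :=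
  (ContinuousMap.norm_le _ (norm_nonneg _)).2 fun y => K.norm_coe_le_norm (x, y)

/-- The operator `φ ↦ (x ↦ ⟪H x, L (K(x, ·) φ)⟫)` on `C(X)`. With `H x = h(|x - ·|)` in `L²(S²)`,
it is the exact integral operator when `L` is the inclusion of `C(S²)` into `L²(S²)`, and the
operator of the numerical scheme when `L` is hyperinterpolation. -/
noncomputable def kernelOp (H : C(X, V)) (K : C(X × X, ℝ)) (L : C(X, ℝ) →L[ℝ] V) :
    C(X, ℝ) →L[ℝ] C(X, ℝ) :=
  LinearMap.mkContinuous
    { toFun := fun φ => ⟨fun x => inner ℝ (H x) (L (K.curry x * φ)), by fun_prop⟩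
      map_add' := fun φ ψ => by ext x; simp [mul_add, inner_add_right]
      map_smul' := fun c φ => by ext x; simp [inner_smul_right] }
    (‖H‖ * (‖L‖ * ‖K‖)) fun φ => by
      refine (ContinuousMap.norm_le _ (by positivity)).2 fun x => ?_
      have hK := norm_curry_le K x
      calc ‖inner ℝ (H x) (L (K.curry x * φ))‖ ≤ ‖H x‖ * ‖L (K.curry x * φ)‖ :=
            norm_inner_le_norm _ _
        _ ≤ ‖H‖ * (‖L‖ * (‖K‖ * ‖φ‖)) := by
            gcongr
            · exact H.norm_coe_le_norm x
            · refine (L.le_opNorm _).trans ?_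
              gcongr
              exact (norm_mul_le _ _).trans (by gcongr)
        _ = _ := by ring

theorem kernelOp_apply (H : C(X, V)) (K : C(X × X, ℝ)) (L : C(X, ℝ) →L[ℝ] V) (φ : C(X, ℝ))
    (x : X) : kernelOp H K L φ x = inner ℝ (H x) (L (K.curry x * φ)) := rfl

/-- The operators `kernelOp H K L` with `‖L‖ ≤ B` are collectively compact: the modulus of
continuity of `kernelOp H K L φ` depends on `H` and `K` only, so the Arzelà-Ascoli theorem
applies to all of them at once. -/
theorem exists_isCompact_kernelOp_mem (H : C(X, V)) (K : C(X × X, ℝ)) (B : ℝ) :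
    ∃ S : Set C(X, ℝ), IsCompact S ∧ ∀ L : C(X, ℝ) →L[ℝ] V, ‖L‖ ≤ B → ∀ φ : C(X, ℝ), ‖φ‖ ≤ 1 →
      kernelOp H K L φ ∈ S := by
  let e := ContinuousMap.isometryEquivBoundedOfCompact X ℝ
  let A : Set (BoundedContinuousFunction X ℝ) :=
    {g | ∃ L : C(X, ℝ) →L[ℝ] V, ‖L‖ ≤ B ∧ ∃ φ : C(X, ℝ), ‖φ‖ ≤ 1 ∧ g = e (kernelOp H K L φ)}
  have key : ∀ L : C(X, ℝ) →L[ℝ] V, ‖L‖ ≤ B → ∀ u : C(X, ℝ), ∀ a, ‖u‖ ≤ a → 0 ≤ a →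
      ‖L u‖ ≤ B * a := fun L hL u a hu ha =>
    (L.le_opNorm u).trans (mul_le_mul hL hu (norm_nonneg _) ((norm_nonneg L).trans hL))
  have hmul : ∀ (k φ : C(X, ℝ)), ‖φ‖ ≤ 1 → ‖k * φ‖ ≤ ‖k‖ := fun k φ hφ =>
    (norm_mul_le _ _).trans (mul_le_of_le_one_right (norm_nonneg _) hφ)
  have hA : IsCompact (closure A) := by
    refine BoundedContinuousFunction.arzela_ascoli (Metric.closedBall 0 (‖H‖ * (B * ‖K‖)))
      (isCompact_closedBall _ _) A ?_ ?_
    · rintro _ x ⟨L, hL, φ, hφ, rfl⟩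
      rw [mem_closedBall_zero_iff]
      change ‖inner ℝ (H x) (L (K.curry x * φ))‖ ≤ _
      refine (norm_inner_le_norm _ _).trans (mul_le_mul (H.norm_coe_le_norm x) ?_
        (norm_nonneg _) (norm_nonneg _))
      exact key L hL _ _ ((hmul _ _ hφ).trans (norm_curry_le K x)) (norm_nonneg _)
    · intro x₀
      refine Metric.equicontinuousAt_of_continuity_modulus
        (fun x => ‖H x₀ - H x‖ * (B * ‖K‖) + ‖H‖ * (B * ‖K.curry x₀ - K.curry x‖)) ?_ _ ?_
      · have hc : Continuous fun x =>
            ‖H x₀ - H x‖ * (B * ‖K‖) + ‖H‖ * (B * ‖K.curry x₀ - K.curry x‖) := by fun_prop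
        simpa using hc.tendsto x₀
      · refine Filter.Eventually.of_forall ?_
        rintro x ⟨_, L, hL, φ, hφ, rfl⟩
        rw [dist_eq_norm]
        change ‖inner ℝ (H x₀) (L (K.curry x₀ * φ)) - inner ℝ (H x) (L (K.curry x * φ))‖ ≤ _
        have hsplit : inner ℝ (H x₀) (L (K.curry x₀ * φ)) - inner ℝ (H x) (L (K.curry x * φ)) =
            inner ℝ (H x₀ - H x) (L (K.curry x₀ * φ)) +
              inner ℝ (H x) (L ((K.curry x₀ - K.curry x) * φ)) := by
          rw [sub_mul, map_sub, inner_sub_left, inner_sub_right]; ring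
        rw [hsplit]
        refine (norm_add_le _ _).trans (add_le_add ?_ ?_)
        · refine (norm_inner_le_norm _ _).trans (mul_le_mul_of_nonneg_left ?_ (norm_nonneg _))
          exact key L hL _ _ ((hmul _ _ hφ).trans (norm_curry_le K x₀)) (norm_nonneg _)
        · refine (norm_inner_le_norm _ _).trans (mul_le_mul (H.norm_coe_le_norm x) ?_
            (norm_nonneg _) (norm_nonneg _))
          exact key L hL _ _ (hmul _ _ hφ) (norm_nonneg _)
  refine ⟨e.symm '' closure A, hA.image e.symm.continuous, fun L hL φ hφ => ?_⟩
  exact ⟨e (kernelOp H K L φ), subset_closure ⟨L, hL, φ, hφ, rfl⟩, e.symm_apply_apply _⟩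

theorem norm_kernelOp_sub_apply_le (H : C(X, V)) (K : C(X × X, ℝ)) (L L' : C(X, ℝ) →L[ℝ] V)
    (φ : C(X, ℝ)) (x : X) : ‖kernelOp H K L φ x - kernelOp H K L' φ x‖ ≤
      ‖H‖ * ‖L (K.curry x * φ) - L' (K.curry x * φ)‖ := by
  rw [kernelOp_apply, kernelOp_apply, ← inner_sub_right]
  exact (norm_inner_le_norm _ _).trans (by gcongr; exact H.norm_coe_le_norm x)

theorem isCompactOperator_kernelOp (H : C(X, V)) (K : C(X × X, ℝ)) (L : C(X, ℝ) →L[ℝ] V) :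
    IsCompactOperator (kernelOp H K L) := by
  obtain ⟨S, hS, hmem⟩ := exists_isCompact_kernelOp_mem H K ‖L‖
  refine ⟨S, hS, Filter.mem_of_superset (Metric.closedBall_mem_nhds 0 one_pos) fun φ hφ => ?_⟩
  exact hmem L le_rfl φ (mem_closedBall_zero_iff.1 hφ)

end KernelOperator

/-! ### Stability under collectively compact approximation -/

open Filter Topology in
/-- **Stability of collectively compact approximations.** If the operators `A i` map the unit ball
into one compact set and converge pointwise to `A₀`, and `1 - A₀` is injective, then the operators
`1 - A i` are eventually bounded below by one constant. -/
theorem eventually_norm_le_mul_norm_sub {ι X : Type*} [NormedAddCommGroup X] [NormedSpace ℝ X]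
    {l : Filter ι} {A : ι → X →L[ℝ] X} {A₀ : X →L[ℝ] X} {S : Set X} (hS : IsCompact S)
    (hA : ∀ᶠ i in l, ∀ φ, ‖φ‖ ≤ 1 → A i φ ∈ S)
    (hlim : ∀ φ, Tendsto (fun i => A i φ) l (𝓝 (A₀ φ)))
    (hinj : ∀ φ, φ = A₀ φ → φ = 0) :
    ∃ c : ℝ, 0 < c ∧ ∀ᶠ i in l, ∀ φ, ‖φ‖ ≤ c * ‖φ - A i φ‖ := by
  by_contra! hcon
  -- Along `F`, the pairs `(i, φ)` have `i` tending to `l`, `‖φ‖ = 1` and `φ - A i φ` tending to `0`.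
  let F : Filter (ι × X) := comap Prod.fst l ⊓
    (𝓟 {p | ‖p.2‖ = 1} ⊓ comap (fun p => p.2 - A p.1 p.2) (𝓝 0))
  have hF : F.NeBot := by
    rw [← forall_mem_nonempty_iff_neBot]
    intro s hs
    obtain ⟨t₁, ⟨u, hu, hut⟩, t₂, ht₂, rfl⟩ := mem_inf_iff.1 hs
    obtain ⟨t₃, ht₃, t₄, ⟨w, hw, hwt⟩, rfl⟩ := mem_inf_iff.1 ht₂
    obtain ⟨ε, hε, hεw⟩ := Metric.mem_nhds_iff.1 hw
    obtain ⟨i, ⟨φ, hφ⟩, hi⟩ := ((hcon ε⁻¹ (by positivity)).and_eventually hu).exists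
    have h0 : 0 < ‖φ‖ := lt_of_le_of_lt (by positivity) hφ
    refine ⟨(i, ‖φ‖⁻¹ • φ), hut hi, ht₃ (by simp [norm_smul, h0.ne']), hwt (hεw ?_)⟩
    rw [mem_ball_zero_iff]
    change ‖‖φ‖⁻¹ • φ - A i (‖φ‖⁻¹ • φ)‖ < ε
    rw [map_smul, ← smul_sub, norm_smul, norm_inv, norm_norm, inv_mul_lt_iff₀ h0]
    rwa [inv_mul_lt_iff₀ hε, mul_comm] at hφ
  let U : Ultrafilter (ι × X) := Ultrafilter.of F
  have hUF : (U : Filter (ι × X)) ≤ F := Ultrafilter.of_le F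
  have hU₁ : Tendsto Prod.fst (U : Filter (ι × X)) l :=
    tendsto_iff_comap.2 (hUF.trans inf_le_left)
  have hU₂ : ∀ᶠ p : ι × X in U, ‖p.2‖ = 1 :=
    (hUF.trans (inf_le_right.trans inf_le_left)) (mem_principal_self _)
  have hU₃ : Tendsto (fun p : ι × X => p.2 - A p.1 p.2) U (𝓝 0) :=
    tendsto_iff_comap.2 (hUF.trans (inf_le_right.trans inf_le_right))
  obtain ⟨ψ, -, hψ⟩ := hS.ultrafilter_le_nhds (U.map fun p => A p.1 p.2) (by
    rw [le_principal_iff]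
    change ∀ᶠ p : ι × X in U, A p.1 p.2 ∈ S
    filter_upwards [hU₁.eventually hA, hU₂] with p hp hp2 using hp _ hp2.le)
  have hAψ : Tendsto (fun p : ι × X => A p.1 p.2) U (𝓝 ψ) := hψ
  have hsnd : Tendsto (fun p : ι × X => p.2) U (𝓝 ψ) := by
    simpa using hU₃.add hAψ
  have hnorm : ‖ψ‖ = 1 :=
    tendsto_nhds_unique (hsnd.norm) (tendsto_const_nhds.congr' (hU₂.mono fun p hp => hp.symm))
  obtain ⟨M, hM⟩ := hS.isBounded.exists_norm_le
  have hbd : ∀ i, (∀ φ, ‖φ‖ ≤ 1 → A i φ ∈ S) → ∀ φ, ‖A i φ‖ ≤ M * ‖φ‖ := by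
    intro i hi φ
    rcases eq_or_ne φ 0 with rfl | h0
    · simp
    have h1 := hM _ (hi (‖φ‖⁻¹ • φ) (by simp [norm_smul, h0]))
    rw [map_smul, norm_smul, norm_inv, norm_norm, inv_mul_le_iff₀ (norm_pos_iff.2 h0)] at h1
    rwa [mul_comm]
  have hdiff : Tendsto (fun p : ι × X => A p.1 p.2 - A p.1 ψ) U (𝓝 0) := by
    have h0 : Tendsto (fun p : ι × X => M * ‖p.2 - ψ‖) U (𝓝 0) := by
      simpa using (hsnd.sub_const ψ).norm.const_mul M
    refine squeeze_zero_norm' ?_ h0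
    filter_upwards [hU₁.eventually hA] with p hp
    rw [← map_sub]
    exact hbd _ hp _
  have hfix : ψ = A₀ ψ := by
    have h1 := hAψ.sub hdiff
    simp only [sub_sub_cancel, sub_zero] at h1
    exact tendsto_nhds_unique h1 ((hlim ψ).comp hU₁)
  rw [hinj ψ hfix] at hnorm
  simp at hnorm

/-! ### Density of the spherical polynomials -/

/-- The restriction of polynomials in three variables to the sphere. -/
noncomputable def sphRestrict : MvPolynomial (Fin 3) ℝ →ₐ[ℝ] C(S2, ℝ) :=
  MvPolynomial.aeval fun i => ⟨fun x => x.1 i, by fun_prop⟩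

theorem sphRestrict_apply (p : MvPolynomial (Fin 3) ℝ) (x : S2) :
    sphRestrict p x = MvPolynomial.eval (fun i => x.1 i) p := by
  induction p using MvPolynomial.induction_on with
  | C a => simp [sphRestrict]
  | add p q hp hq => simp [hp, hq]
  | mul_X p i hp => simp [hp]; simp [sphRestrict]

/-- Restrictions to the sphere of the polynomials of total degree at most `n`. -/
noncomputable def sphRestrictDegreeLE (n : ℕ) : Submodule ℝ C(S2, ℝ) :=
  (MvPolynomial.restrictTotalDegree (Fin 3) ℝ n).map sphRestrict.toLinearMap

theorem sphHarmonics_le_sphRestrictDegreeLE {ℓ n : ℕ} (h : ℓ ≤ n) :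
    sphHarmonics ℓ ≤ sphRestrictDegreeLE n := by
  rintro g ⟨p, hp, -, hg⟩
  refine ⟨p, ?_, ?_⟩
  · exact (MvPolynomial.mem_restrictTotalDegree _ _ _).2 (hp.totalDegree_le.trans h)
  · ext x; rw [hg]; exact sphRestrict_apply p x

theorem sphPoly_le_sphRestrictDegreeLE (n : ℕ) : sphPoly n ≤ sphRestrictDegreeLE n :=
  iSup₂_le fun _ hℓ =>
    sphHarmonics_le_sphRestrictDegreeLE (Nat.lt_succ_iff.1 (Finset.mem_range.1 hℓ))

/-- The restriction of the monomial `x ^ a * y ^ b * z ^ c`. -/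
noncomputable def sphMonomial (a b c : ℕ) : C(S2, ℝ) :=
  sphRestrict (MvPolynomial.X 0 ^ a * MvPolynomial.X 1 ^ b * MvPolynomial.X 2 ^ c)

theorem sphMonomial_apply (a b c : ℕ) (x : S2) :
    sphMonomial a b c x = x.1 0 ^ a * x.1 1 ^ b * x.1 2 ^ c := by
  rw [sphMonomial, sphRestrict_apply]
  simp

/-- The relation `z ^ 2 = 1 - x ^ 2 - y ^ 2` on the sphere. -/
theorem sphMonomial_add_two (a b c : ℕ) :
    sphMonomial a b (c + 2) = sphMonomial a b c - sphMonomial (a + 2) b c -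
      sphMonomial a (b + 2) c := by
  ext x
  have hx : x.1 0 ^ 2 + x.1 1 ^ 2 + x.1 2 ^ 2 = 1 := by
    have h1 : ‖x.1‖ = 1 := by simp
    have h2 := EuclideanSpace.norm_sq_eq x.1
    rw [h1, Fin.sum_univ_three] at h2
    simpa using h2.symm
  simp only [ContinuousMap.sub_apply, sphMonomial_apply]
  linear_combination (x.1 0 ^ a * x.1 1 ^ b * x.1 2 ^ c) * hx

/-- Monomials of degree `ℓ` and at most linear in `z`, listed by `Fin (2 * ℓ + 1)`: the `ℓ + 1`
monomials `x ^ k * y ^ (ℓ - k)`, then the `ℓ` monomials `x ^ j * y ^ (ℓ - 1 - j) * z`. -/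
noncomputable def reducedMonomial (n : ℕ) (p : Σ ℓ : Fin (n + 1), Fin (2 * (ℓ : ℕ) + 1)) :
    C(S2, ℝ) :=
  if (p.2 : ℕ) ≤ p.1 then sphMonomial p.2 (p.1 - p.2) 0
  else sphMonomial (p.2 - p.1 - 1) (2 * p.1 - p.2) 1

theorem sphMonomial_mem_span (n : ℕ) : ∀ c a b : ℕ, a + b + c ≤ n →
    sphMonomial a b c ∈ Submodule.span ℝ (range (reducedMonomial n))
  | 0, a, b, h => by
    refine Submodule.subset_span
      ⟨⟨⟨a + b, by omega⟩, ⟨a, by simp only; omega⟩⟩, ?_⟩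
    simp [reducedMonomial]
  | 1, a, b, h => by
    refine Submodule.subset_span
      ⟨⟨⟨a + b + 1, by omega⟩, ⟨a + (a + b + 1) + 1, by simp only; omega⟩⟩, ?_⟩
    have h1 : ¬ (a + (a + b + 1) + 1 ≤ a + b + 1) := by omega
    simp only [reducedMonomial, if_neg h1]
    congr 1 <;> omega
  | c + 2, a, b, h => by
    rw [sphMonomial_add_two]
    exact sub_mem (sub_mem (sphMonomial_mem_span n c a b (by omega))
      (sphMonomial_mem_span n c (a + 2) b (by omega)))
      (sphMonomial_mem_span n c a (b + 2) (by omega))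

theorem sphRestrictDegreeLE_le_span (n : ℕ) :
    sphRestrictDegreeLE n ≤ Submodule.span ℝ (range (reducedMonomial n)) := by
  rintro _ ⟨p, hp, rfl⟩
  have hp : p.totalDegree ≤ n := (MvPolynomial.mem_restrictTotalDegree _ _ _).1 hp
  change sphRestrict p ∈ _
  rw [p.as_sum, map_sum]
  refine sum_mem fun s hs => ?_
  have hdeg := (MvPolynomial.le_totalDegree hs).trans hp
  rw [Finsupp.sum_fintype _ _ (fun _ => rfl), Fin.sum_univ_three] at hdeg
  have : sphRestrict (MvPolynomial.monomial s (p.coeff s)) =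
      p.coeff s • sphMonomial (s 0) (s 1) (s 2) := by
    rw [sphMonomial, ← map_smul, MvPolynomial.monomial_eq,
      Finsupp.prod_fintype _ _ (fun _ => pow_zero _), Fin.prod_univ_three, MvPolynomial.smul_eq_C_mul]
  rw [this]
  exact Submodule.smul_mem _ _ (sphMonomial_mem_span n _ _ _ hdeg)

section Harmonics

variable {Y : (ℓ : ℕ) → Fin (2 * ℓ + 1) → C(S2, ℝ)}

theorem IsSphHarmonicSystem.mem_sphPoly (hY : IsSphHarmonicSystem Y) {n ℓ : ℕ} (h : ℓ ≤ n)
    (k : Fin (2 * ℓ + 1)) : Y ℓ k ∈ sphPoly n := by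
  have h1 : Y ℓ k ∈ sphHarmonics ℓ := hY.span_eq ℓ ▸ Submodule.subset_span ⟨k, rfl⟩
  exact (le_iSup₂_of_le (f := fun ℓ (_ : ℓ ∈ Finset.range (n + 1)) => sphHarmonics ℓ) ℓ
    (Finset.mem_range.2 (Nat.lt_succ_iff.2 h)) le_rfl) h1

theorem IsSphHarmonicSystem.orthonormal (hY : IsSphHarmonicSystem Y) :
    Orthonormal ℝ fun p : Σ ℓ : ℕ, Fin (2 * ℓ + 1) => toSphL2 (Y p.1 p.2) := by
  refine ⟨fun p => ?_, fun p q hpq => ?_⟩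
  · rw [norm_eq_sqrt_real_inner, inner_toSphL2_toSphL2, hY.norm_one, Real.sqrt_one]
  · change inner ℝ _ _ = (0 : ℝ)
    rw [inner_toSphL2_toSphL2, hY.orthogonal p q hpq]

/-- The members of the system `Y` of degree at most `n`. -/
def harmonicsUpTo (Y : (ℓ : ℕ) → Fin (2 * ℓ + 1) → C(S2, ℝ)) (n : ℕ)
    (p : Σ ℓ : Fin (n + 1), Fin (2 * (ℓ : ℕ) + 1)) : C(S2, ℝ) :=
  Y p.1 p.2

theorem IsSphHarmonicSystem.linearIndependent_harmonicsUpTo (hY : IsSphHarmonicSystem Y) (n : ℕ) :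
    LinearIndependent ℝ (harmonicsUpTo Y n) := by
  have hinj : Function.Injective (Sigma.map (fun i : Fin (n + 1) => (i : ℕ)) fun _ => id :
      (Σ ℓ : Fin (n + 1), Fin (2 * (ℓ : ℕ) + 1)) → Σ ℓ : ℕ, Fin (2 * ℓ + 1)) :=
    Fin.val_injective.sigma_map fun _ => Function.injective_id
  have hli : LinearIndependent ℝ (toSphL2.toLinearMap ∘ harmonicsUpTo Y n) := by
    have h := hY.orthonormal.linearIndependent.comp _ hinj
    exact h
  exact LinearIndependent.of_comp _ hli

theorem IsSphHarmonicSystem.span_harmonicsUpTo_le (hY : IsSphHarmonicSystem Y) (n : ℕ) :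
    Submodule.span ℝ (range (harmonicsUpTo Y n)) ≤ sphPoly n :=
  Submodule.span_le.2 (range_subset_iff.2 fun p => hY.mem_sphPoly (Nat.lt_succ_iff.1 p.1.2) p.2)

/-- The harmonics of degree at most `n` number `(n + 1) ^ 2`, as many as the monomials that span
the restrictions of polynomials of degree at most `n`; so the two spaces agree. -/
theorem IsSphHarmonicSystem.span_harmonicsUpTo_eq (hY : IsSphHarmonicSystem Y) (n : ℕ) :
    Submodule.span ℝ (range (harmonicsUpTo Y n)) =
      Submodule.span ℝ (range (reducedMonomial n)) := by
  have hfd : FiniteDimensional ℝ (Submodule.span ℝ (range (reducedMonomial n))) :=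
    FiniteDimensional.span_of_finite ℝ (finite_range _)
  refine Submodule.eq_of_le_of_finrank_le ((hY.span_harmonicsUpTo_le n).trans
      ((sphPoly_le_sphRestrictDegreeLE n).trans (sphRestrictDegreeLE_le_span n))) ?_
  rw [finrank_span_eq_card (hY.linearIndependent_harmonicsUpTo n)]
  exact finrank_range_le_card (R := ℝ) (reducedMonomial n)

theorem IsSphHarmonicSystem.sphPoly_eq (hY : IsSphHarmonicSystem Y) (n : ℕ) :
    sphPoly n = sphRestrictDegreeLE n :=
  le_antisymm (sphPoly_le_sphRestrictDegreeLE n) ((sphRestrictDegreeLE_le_span n).trans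
    (hY.span_harmonicsUpTo_eq n ▸ hY.span_harmonicsUpTo_le n))

theorem sphPoly_mono : Monotone sphPoly := fun _ _ h =>
  biSup_mono fun _ hℓ => Finset.range_mono (Nat.succ_le_succ h) hℓ

instance finiteDimensional_sphPoly (n : ℕ) : FiniteDimensional ℝ (sphPoly n) := by
  have hfd : FiniteDimensional ℝ (Submodule.span ℝ (range (reducedMonomial n))) :=
    FiniteDimensional.span_of_finite ℝ (finite_range _)
  exact Submodule.finiteDimensional_of_le
    ((sphPoly_le_sphRestrictDegreeLE n).trans (sphRestrictDegreeLE_le_span n))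

theorem one_mem_sphPoly (n : ℕ) : (1 : C(S2, ℝ)) ∈ sphPoly n := by
  have h1 : (1 : C(S2, ℝ)) ∈ sphHarmonics 0 :=
    ⟨1, MvPolynomial.isHomogeneous_one _ _, by simp, by simp⟩
  exact (le_iSup₂_of_le (f := fun ℓ (_ : ℓ ∈ Finset.range (n + 1)) => sphHarmonics ℓ) 0
    (by simp) le_rfl) h1

theorem IsSphHarmonicSystem.exists_norm_sub_lt (hY : IsSphHarmonicSystem Y) (g : C(S2, ℝ)) {ε : ℝ}
    (hε : 0 < ε) : ∃ n, ∃ χ ∈ sphPoly n, ‖g - χ‖ < ε := by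
  have hsep : sphRestrict.range.SeparatesPoints := by
    intro x y hxy
    have : ∃ i, x.1 i ≠ y.1 i := by
      by_contra! h
      exact hxy (Subtype.ext (PiLp.ext h))
    obtain ⟨i, hi⟩ := this
    refine ⟨_, ⟨sphRestrict (MvPolynomial.X i), ⟨_, rfl⟩, rfl⟩, ?_⟩
    simpa [sphRestrict_apply] using hi
  obtain ⟨⟨_, p, rfl⟩, hp⟩ :=
    ContinuousMap.exists_mem_subalgebra_near_continuousMap_of_separatesPoints _ hsep g ε hε
  refine ⟨p.totalDegree, sphRestrict p, ?_, ?_⟩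
  · rw [hY.sphPoly_eq]
    exact ⟨p, (MvPolynomial.mem_restrictTotalDegree _ _ _).2 le_rfl, rfl⟩
  · rw [norm_sub_rev]; exact hp

/-- Polynomial approximation is uniform on compact sets of continuous functions. -/
theorem IsSphHarmonicSystem.exists_forall_norm_sub_lt (hY : IsSphHarmonicSystem Y)
    {S : Set C(S2, ℝ)} (hS : IsCompact S) {ε : ℝ} (hε : 0 < ε) :
    ∃ N, ∀ n, N ≤ n → ∀ g ∈ S, ∃ χ ∈ sphPoly n, ‖g - χ‖ < ε := by
  obtain ⟨N, hN⟩ := hS.elim_directed_cover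
    (fun n => ⋃ χ ∈ sphPoly n, Metric.ball (χ : C(S2, ℝ)) ε)
    (fun n => isOpen_biUnion fun _ _ => Metric.isOpen_ball)
    (fun g _ => by
      obtain ⟨n, χ, hχ, h⟩ := hY.exists_norm_sub_lt g hε
      exact mem_iUnion.2 ⟨n, mem_iUnion₂.2 ⟨χ, hχ, by rwa [Metric.mem_ball, dist_eq_norm]⟩⟩)
    (directed_of_isDirected_le fun i j hij =>
      biUnion_mono (sphPoly_mono hij) fun _ _ => le_rfl)
  refine ⟨N, fun n hn g hg => ?_⟩
  obtain ⟨χ, hχ, h⟩ := mem_iUnion₂.1 (hN hg)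
  exact ⟨χ, sphPoly_mono hn hχ, by rwa [Metric.mem_ball, dist_eq_norm] at h⟩

end Harmonics

/-! ### Hyperinterpolation -/

section Hyperinterpolation

variable {Y : (ℓ : ℕ) → Fin (2 * ℓ + 1) → C(S2, ℝ)}

theorem IsSphHarmonicSystem.sphPoly_eq_span (hY : IsSphHarmonicSystem Y) (n : ℕ) :
    sphPoly n = Submodule.span ℝ (range (harmonicsUpTo Y n)) :=
  le_antisymm ((sphPoly_le_sphRestrictDegreeLE n).trans
    ((sphRestrictDegreeLE_le_span n).trans (hY.span_harmonicsUpTo_eq n).ge))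
    (hY.span_harmonicsUpTo_le n)

theorem IsSphHarmonicSystem.hyperinterp_mem (hY : IsSphHarmonicSystem Y) {m : ℕ}
    (Q : SphQuadrature m) (n : ℕ) (g : C(S2, ℝ)) : hyperinterp Y Q n g ∈ sphPoly n :=
  sum_mem fun _ hℓ => sum_mem fun k _ => Submodule.smul_mem _ _
    (hY.mem_sphPoly (Nat.lt_succ_iff.1 (Finset.mem_range.1 hℓ)) k)

/-- Hyperinterpolation is the orthogonal projection for the discrete inner product: testing it
against `χ ∈ ℙ_n` in `L²(S²)` amounts to testing the data against `χ` at the nodes. -/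
theorem IsSphHarmonicSystem.inner_hyperinterp (hY : IsSphHarmonicSystem Y) {m : ℕ}
    (Q : SphQuadrature m) (n : ℕ) (g : C(S2, ℝ)) {χ : C(S2, ℝ)} (hχ : χ ∈ sphPoly n) :
    inner ℝ (toSphL2 (hyperinterp Y Q n g)) (toSphL2 χ) =
      ∑ j, Q.weight j * g (Q.node j) * χ (Q.node j) := by
  rw [hY.sphPoly_eq_span] at hχ
  induction hχ using Submodule.span_induction with
  | mem χ hχ =>
    obtain ⟨p, rfl⟩ := hχ
    let s : Finset (Σ ℓ : ℕ, Fin (2 * ℓ + 1)) :=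
      (Finset.range (n + 1)).sigma fun _ => Finset.univ
    have hs : (⟨p.1, p.2⟩ : Σ ℓ : ℕ, Fin (2 * ℓ + 1)) ∈ s := by
      simpa [s] using Nat.lt_succ_iff.1 p.1.2
    have h1 : toSphL2 (hyperinterp Y Q n g) = ∑ q ∈ s,
        (∑ j, Q.weight j * g (Q.node j) * Y q.1 q.2 (Q.node j)) • toSphL2 (Y q.1 q.2) := by
      rw [Finset.sum_sigma, hyperinterp, map_sum]
      refine Finset.sum_congr rfl fun ℓ _ => ?_
      rw [map_sum]
      exact Finset.sum_congr rfl fun k _ => map_smul _ _ _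
    rw [h1]
    exact hY.orthonormal.inner_left_sum _ hs
  | zero => simp
  | add χ ψ _ _ h1 h2 =>
    rw [map_add, inner_add_right, h1, h2, ← Finset.sum_add_distrib]
    exact Finset.sum_congr rfl fun j _ => by rw [ContinuousMap.add_apply]; ring
  | smul c χ _ h1 =>
    rw [map_smul, inner_smul_right, h1, Finset.mul_sum]
    exact Finset.sum_congr rfl fun j _ => by rw [ContinuousMap.smul_apply, smul_eq_mul]; ring

/-- Hyperinterpolation as a continuous linear operator on `C(S²)`. -/
noncomputable def hyperinterpCLM (Y : (ℓ : ℕ) → Fin (2 * ℓ + 1) → C(S2, ℝ)) {m : ℕ}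
    (Q : SphQuadrature m) (n : ℕ) : C(S2, ℝ) →L[ℝ] C(S2, ℝ) :=
  ∑ ℓ ∈ Finset.range (n + 1), ∑ k : Fin (2 * ℓ + 1),
    (∑ j, (Q.weight j * Y ℓ k (Q.node j)) •
      ContinuousMap.evalCLM ℝ (Q.node j)).smulRight (Y ℓ k)

theorem hyperinterpCLM_apply {m : ℕ} (Q : SphQuadrature m) (n : ℕ) (g : C(S2, ℝ)) :
    hyperinterpCLM Y Q n g = hyperinterp Y Q n g := by
  simp only [hyperinterpCLM, hyperinterp, sum_apply,
    ContinuousLinearMap.smulRight_apply, smul_apply]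
  refine Finset.sum_congr rfl fun ℓ _ => Finset.sum_congr rfl fun k _ => ?_
  congr 1
  refine Finset.sum_congr rfl fun j _ => ?_
  change Q.weight j * Y ℓ k (Q.node j) * g (Q.node j) = _
  ring

section MZ

variable {m n : ℕ} {η : ℝ} {Q : SphQuadrature m}

theorem SphQuadrature.IsMZ.le_sum (hQ : Q.IsMZ n η) {χ : C(S2, ℝ)} (hχ : χ ∈ sphPoly n) :
    (1 - η) * ‖toSphL2 χ‖ ^ 2 ≤ ∑ j, Q.weight j * χ (Q.node j) ^ 2 :=
  norm_toSphL2_sq χ ▸ (hQ.2.2 χ hχ).1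

theorem SphQuadrature.IsMZ.sum_le (hQ : Q.IsMZ n η) {χ : C(S2, ℝ)} (hχ : χ ∈ sphPoly n) :
    ∑ j, Q.weight j * χ (Q.node j) ^ 2 ≤ (1 + η) * ‖toSphL2 χ‖ ^ 2 :=
  norm_toSphL2_sq χ ▸ (hQ.2.2 χ hχ).2

theorem SphQuadrature.IsMZ.sum_weight_le (hQ : Q.IsMZ n η) :
    ∑ j, Q.weight j ≤ (1 + η) * surf.real univ := by
  simpa using (hQ.2.2 1 (one_mem_sphPoly n)).2

/-- By the Cauchy–Schwarz inequality for the discrete inner product. -/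
theorem IsSphHarmonicSystem.norm_hyperinterp_sq_le (hY : IsSphHarmonicSystem Y)
    (hQ : Q.IsMZ n η) (g : C(S2, ℝ)) : ‖toSphL2 (hyperinterp Y Q n g)‖ ^ 2 ≤
      (1 + η) * ∑ j, Q.weight j * g (Q.node j) ^ 2 := by
  set u := hyperinterp Y Q n g with hu
  have hmem : u ∈ sphPoly n := hY.hyperinterp_mem Q n g
  have h1 : ‖toSphL2 u‖ ^ 2 = ∑ j, Q.weight j * g (Q.node j) * u (Q.node j) := by
    rw [← real_inner_self_eq_norm_sq, ← hY.inner_hyperinterp Q n g hmem, ← hu]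
  have h2 : (∑ j, Q.weight j * g (Q.node j) * u (Q.node j)) ^ 2 ≤
      (∑ j, Q.weight j * g (Q.node j) ^ 2) * ∑ j, Q.weight j * u (Q.node j) ^ 2 :=
    Finset.sum_sq_le_sum_mul_sum_of_sq_le_mul _
      (fun j _ => mul_nonneg (Q.weight_pos j).le (sq_nonneg _))
      (fun j _ => mul_nonneg (Q.weight_pos j).le (sq_nonneg _)) fun j _ => le_of_eq (by ring)
  have hD : 0 ≤ ∑ j, Q.weight j * g (Q.node j) ^ 2 :=
    Finset.sum_nonneg fun j _ => mul_nonneg (Q.weight_pos j).le (sq_nonneg _)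
  have h3 := h2.trans (mul_le_mul_of_nonneg_left (hQ.sum_le hmem) hD)
  rw [← h1] at h3
  rcases (sq_nonneg ‖toSphL2 u‖).eq_or_lt with h0 | h0
  · rw [← h0]; exact mul_nonneg (by linarith [hQ.1]) hD
  · refine le_of_mul_le_mul_right ?_ h0
    linarith

/-- The `C(S²) → L²(S²)` norm of hyperinterpolation is bounded independently of the rule. -/
theorem IsSphHarmonicSystem.norm_hyperinterp_le (hY : IsSphHarmonicSystem Y)
    (hQ : Q.IsMZ n η) (g : C(S2, ℝ)) : ‖toSphL2 (hyperinterp Y Q n g)‖ ≤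
      2 * Real.sqrt (surf.real univ) * ‖g‖ := by
  refine abs_le_of_sq_le_sq' ?_ (by positivity) |>.2
  have hη := hQ.1
  have hη' := hQ.2.1
  have hD : ∑ j, Q.weight j * g (Q.node j) ^ 2 ≤ (1 + η) * surf.real univ * ‖g‖ ^ 2 :=
    calc ∑ j, Q.weight j * g (Q.node j) ^ 2 ≤ ∑ j, Q.weight j * ‖g‖ ^ 2 := by
          refine Finset.sum_le_sum fun j _ => mul_le_mul_of_nonneg_left ?_ (Q.weight_pos j).le
          exact sq_le_sq.2 (by simpa using g.norm_coe_le_norm (Q.node j))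
      _ ≤ _ := by
          rw [← Finset.sum_mul]
          exact mul_le_mul_of_nonneg_right hQ.sum_weight_le (sq_nonneg _)
  calc ‖toSphL2 (hyperinterp Y Q n g)‖ ^ 2
      ≤ (1 + η) * ((1 + η) * surf.real univ * ‖g‖ ^ 2) :=
        (hY.norm_hyperinterp_sq_le hQ g).trans (mul_le_mul_of_nonneg_left hD (by linarith))
    _ = (1 + η) ^ 2 * (surf.real univ * ‖g‖ ^ 2) := by ring
    _ ≤ 2 ^ 2 * (surf.real univ * ‖g‖ ^ 2) := by gcongr; linarith
    _ = _ := by rw [mul_pow, mul_pow, Real.sq_sqrt measureReal_nonneg]; ring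

/-- Expanding the square gives `‖𝓛_n χ - χ‖² ≤ (1 - (1 - η)²) ‖χ‖² = (2η - η²) ‖χ‖²`. -/
theorem IsSphHarmonicSystem.norm_hyperinterp_sub_self_le (hY : IsSphHarmonicSystem Y)
    (hQ : Q.IsMZ n η) {χ : C(S2, ℝ)} (hχ : χ ∈ sphPoly n) :
    ‖toSphL2 (hyperinterp Y Q n χ) - toSphL2 χ‖ ≤ Real.sqrt (η ^ 2 + 4 * η) * ‖toSphL2 χ‖ := by
  have hη := hQ.1
  refine abs_le_of_sq_le_sq' ?_ (by positivity) |>.2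
  rw [mul_pow, Real.sq_sqrt (by positivity), norm_sub_sq_real, hY.inner_hyperinterp Q n χ hχ]
  have h1 := hY.norm_hyperinterp_sq_le hQ χ
  have h2 := mul_le_mul_of_nonneg_left (hQ.le_sum hχ) (by linarith [hQ.2.1] : 0 ≤ 1 - η)
  have h3 : ∑ j, Q.weight j * χ (Q.node j) * χ (Q.node j) =
      ∑ j, Q.weight j * χ (Q.node j) ^ 2 :=
    Finset.sum_congr rfl fun j _ => by ring
  rw [h3]
  nlinarith [mul_nonneg hη (sq_nonneg ‖toSphL2 χ‖), mul_nonneg (sq_nonneg η)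
    (sq_nonneg ‖toSphL2 χ‖)]

/-- The `L²` error of hyperinterpolation, through an arbitrary `χ ∈ ℙ_n`. -/
theorem IsSphHarmonicSystem.norm_hyperinterp_sub_le (hY : IsSphHarmonicSystem Y)
    (hQ : Q.IsMZ n η) (g : C(S2, ℝ)) {χ : C(S2, ℝ)} (hχ : χ ∈ sphPoly n) :
    ‖toSphL2 (hyperinterp Y Q n g) - toSphL2 g‖ ≤
      3 * Real.sqrt (surf.real univ) * ‖g - χ‖ + Real.sqrt (η ^ 2 + 4 * η) * sphL2Norm χ := by
  have hsplit : toSphL2 (hyperinterp Y Q n g) - toSphL2 g =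
      toSphL2 (hyperinterp Y Q n (g - χ)) - toSphL2 (g - χ) +
        (toSphL2 (hyperinterp Y Q n χ) - toSphL2 χ) := by
    simp only [← hyperinterpCLM_apply, map_sub]
    abel
  rw [hsplit]
  refine (norm_add_le _ _).trans (add_le_add ((norm_sub_le _ _).trans ?_) ?_)
  · linarith [hY.norm_hyperinterp_le hQ (g - χ), norm_toSphL2_le (g - χ)]
  · rw [← norm_toSphL2]
    exact hY.norm_hyperinterp_sub_self_le hQ hχ

end MZ

end Hyperinterpolation

/-! ### Best approximation -/

section BestApproximation

theorem bestError_le {n : ℕ} (g : C(S2, ℝ)) {χ : C(S2, ℝ)} (hχ : χ ∈ sphPoly n) :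
    bestError n g ≤ ‖g - χ‖ :=
  ciInf_le ⟨0, by rintro _ ⟨_, rfl⟩; exact norm_nonneg _⟩ (⟨χ, hχ⟩ : sphPoly n)

theorem exists_isBestApprox (n : ℕ) (g : C(S2, ℝ)) : ∃ χ, IsBestApprox n g χ := by
  have hproper : ProperSpace (sphPoly n) := FiniteDimensional.proper ℝ _
  have hcoer : Filter.Tendsto (fun χ : sphPoly n => ‖g - (χ : C(S2, ℝ))‖)
      (Filter.cocompact (sphPoly n)) Filter.atTop := by
    refine Filter.tendsto_atTop_mono (fun χ => ?_)
      (Filter.tendsto_atTop_add_const_right _ (-‖g‖) (tendsto_norm_cocompact_atTop (E := sphPoly n)))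
    have := norm_sub_norm_le (χ : C(S2, ℝ)) g
    rw [norm_sub_rev] at this
    simpa [sub_eq_add_neg] using this
  obtain ⟨χ, hχ⟩ := (by fun_prop : Continuous fun χ : sphPoly n =>
    ‖g - (χ : C(S2, ℝ))‖).exists_forall_le hcoer
  exact ⟨χ, χ.2, le_antisymm (le_ciInf hχ) (bestError_le g χ.2)⟩

end BestApproximation

/-! ### Operator form of the scheme -/

/-- The Fredholm alternative for an equation of the second kind. -/
theorem IsCompactOperator.exists_sub_eq {X : Type*} [NormedAddCommGroup X] [NormedSpace ℝ X]
    [CompleteSpace X] {T : X →L[ℝ] X} (hT : IsCompactOperator T) (hinj : ∀ φ, φ = T φ → φ = 0)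
    (f : X) : ∃ φ, φ - T φ = f := by
  rcases hT.hasEigenvalue_or_mem_resolventSet (one_ne_zero (α := ℝ)) with h | h
  · obtain ⟨v, hv⟩ := h.exists_hasEigenvector
    exact absurd (hinj v (by simpa using hv.apply_eq_smul.symm)) hv.2
  · obtain ⟨u, hu⟩ := h
    refine ⟨(↑u⁻¹ : X →L[ℝ] X) f, ?_⟩
    have h1 : (u : X →L[ℝ] X) ((↑u⁻¹ : X →L[ℝ] X) f) = f := by
      rw [← mul_apply_eq_comp, Units.mul_inv]; rfl
    rw [hu] at h1
    simpa using h1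

section Scheme

variable {h : ℝ → ℝ} {H : C(S2, SphL2)} {K : C(S2 × S2, ℝ)}
  {Y : (ℓ : ℕ) → Fin (2 * ℓ + 1) → C(S2, ℝ)} {m n : ℕ} {Q : SphQuadrature m}

theorem kernelOp_toSphL2_apply (hH : ∀ x, H x =ᵐ[surf] fun y => h (dist x y)) (φ : C(S2, ℝ))
    (x : S2) : kernelOp H K toSphL2 φ x = ∫ y, h (dist x y) * K (x, y) * φ y ∂surf := by
  rw [kernelOp_apply, inner_toSphL2 (hH x)]
  refine integral_congr_ae (.of_forall fun y => ?_)
  simp [mul_assoc]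

theorem isExactSolution_iff (hH : ∀ x, H x =ᵐ[surf] fun y => h (dist x y)) (f φ : C(S2, ℝ)) :
    IsExactSolution h K f φ ↔ φ - kernelOp H K toSphL2 φ = f := by
  rw [ContinuousMap.ext_iff]
  exact forall_congr' fun x => by rw [ContinuousMap.sub_apply, kernelOp_toSphL2_apply hH]

/-- The operator of the scheme: `φ ↦ (x ↦ ∫ h(|x - y|) 𝓛_n (K(x, ·) φ)(y) dω(y))`. -/
noncomputable def schemeOp (H : C(S2, SphL2)) (K : C(S2 × S2, ℝ))
    (Y : (ℓ : ℕ) → Fin (2 * ℓ + 1) → C(S2, ℝ)) (Q : SphQuadrature m) (n : ℕ) :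
    C(S2, ℝ) →L[ℝ] C(S2, ℝ) :=
  kernelOp H K (toSphL2 ∘L hyperinterpCLM Y Q n)

theorem schemeOp_apply (hH : ∀ x, H x =ᵐ[surf] fun y => h (dist x y)) (φ : C(S2, ℝ)) (x : S2) :
    schemeOp H K Y Q n φ x =
      ∫ y, h (dist x y) * hyperinterp Y Q n (kernelMul K x φ) y ∂surf := by
  rw [← inner_toSphL2 (hH x), ← hyperinterpCLM_apply]
  rfl

theorem schemeOp_apply_eq_sum (hH : ∀ x, H x =ᵐ[surf] fun y => h (dist x y)) (φ : C(S2, ℝ))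
    (x : S2) : schemeOp H K Y Q n φ x =
      ∑ j, productWeight h Y Q n j x * K (x, Q.node j) * φ (Q.node j) := by
  rw [schemeOp_apply hH, ← inner_toSphL2 (hH x), hyperinterp]
  simp only [map_sum, map_smul, inner_sum, inner_smul_right, inner_toSphL2 (hH x), productWeight,
    Finset.mul_sum, Finset.sum_mul]
  symm
  rw [Finset.sum_comm]
  refine Finset.sum_congr rfl fun ℓ _ => ?_
  rw [Finset.sum_comm]
  refine Finset.sum_congr rfl fun k _ => Finset.sum_congr rfl fun j _ => ?_
  symm
  change Q.weight j * (K (x, Q.node j) * φ (Q.node j)) * _ * _ = _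
  ring

theorem continuous_productWeight (hH : ∀ x, H x =ᵐ[surf] fun y => h (dist x y)) (j : Fin m) :
    Continuous (productWeight h Y Q n j) := by
  unfold productWeight
  simp only [← inner_toSphL2 (hH _)]
  fun_prop

/-- If `1 - schemeOp` is injective, its Fredholm solution `φγ` is what the scheme computes: the
nodal system determines `v` as the values of `φγ` at the nodes, because any `v` extends to a
solution of the operator equation. -/
theorem exists_scheme_solution (hH : ∀ x, H x =ᵐ[surf] fun y => h (dist x y))
    (hinj : ∀ φ, φ = schemeOp H K Y Q n φ → φ = 0) (f : C(S2, ℝ)) :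
    ∃ φγ : C(S2, ℝ), φγ - schemeOp H K Y Q n φγ = f ∧
      (∀ v, SolvesNodalSystem h K f Y Q n v ↔ v = fun j => φγ (Q.node j)) ∧
      ∀ ψ, IsSchemeSolution h K f Y Q n ψ ↔ ψ = φγ := by
  obtain ⟨φγ, hφ⟩ := (isCompactOperator_kernelOp H K _).exists_sub_eq hinj f
  have huniq : ∀ ψ, ψ - schemeOp H K Y Q n ψ = f → ψ = φγ := fun ψ hψ => by
    refine sub_eq_zero.1 (hinj _ ?_)
    rw [← sub_eq_zero, map_sub]
    have h1 : ψ - φγ - (schemeOp H K Y Q n ψ - schemeOp H K Y Q n φγ) =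
      (ψ - schemeOp H K Y Q n ψ) - (φγ - schemeOp H K Y Q n φγ) := by abel
    rw [h1, hψ]
    exact sub_eq_zero.2 hφ.symm
  have hφx : ∀ x, φγ x - ∑ j, productWeight h Y Q n j x * K (x, Q.node j) * φγ (Q.node j) =
      f x := fun x => by
    rw [← schemeOp_apply_eq_sum hH, ← hφ]; rfl
  have hsys : SolvesNodalSystem h K f Y Q n fun j => φγ (Q.node j) := fun i => hφx _
  have hsys' : ∀ v, SolvesNodalSystem h K f Y Q n v → ∀ ψ : C(S2, ℝ),
      (∀ t, ψ t = f t + ∑ j, productWeight h Y Q n j t * K (t, Q.node j) * v j) →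
      ψ = φγ ∧ v = fun j => φγ (Q.node j) := by
    intro v hv ψ hψ
    have hnode : ∀ j, ψ (Q.node j) = v j := fun j => by
      rw [hψ, ← hv j]; ring
    have : ψ = φγ := huniq ψ <| by
      ext x
      rw [ContinuousMap.sub_apply, schemeOp_apply_eq_sum hH]
      simp only [hnode]
      rw [hψ]; ring
    exact ⟨this, by ext j; rw [← this, hnode]⟩
  refine ⟨φγ, hφ, fun v => ⟨fun hv => ?_, fun hv => hv ▸ hsys⟩, fun ψ => ⟨?_, ?_⟩⟩
  · refine (hsys' v hv ⟨fun t => f t + ∑ j, productWeight h Y Q n j t * K (t, Q.node j) * v j,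
      ?_⟩ fun t => rfl).2
    have := fun j => continuous_productWeight (Y := Y) (Q := Q) (n := n) hH j
    fun_prop
  · rintro ⟨v, hv, hψ⟩
    exact (hsys' v hv ψ hψ).1
  · rintro rfl
    exact ⟨_, hsys, fun t => by rw [← hφx t]; ring⟩

end Scheme

/-! ### Convergence, stability and error -/

section Convergence

/-- The index set `Γ`: a quadrature rule with the Marcinkiewicz–Zygmund property, together with
its degree and constant. -/
structure MZRule where
  size : ℕ
  degree : ℕ
  const : ℝ
  rule : SphQuadrature size
  isMZ : rule.IsMZ degree const

open Filter Topology

/-- The filter on `Γ` of the limit `n → ∞`, `η → 0`. -/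
def mzFilter : Filter MZRule :=
  comap (fun γ => (γ.degree, γ.const)) (atTop ×ˢ 𝓝[≥] (0 : ℝ))

theorem eventually_mzFilter {p : MZRule → Prop} : (∀ᶠ γ in mzFilter, p γ) ↔
    ∃ (N : ℕ) (δ : ℝ), 0 < δ ∧ ∀ γ : MZRule, N ≤ γ.degree → γ.const ≤ δ → p γ := by
  rw [mzFilter, (((atTop_basis (α := ℕ)).prod (nhdsGE_basis_Icc (a := (0 : ℝ)))).comap _).eventually_iff]
  constructor
  · rintro ⟨⟨N, δ⟩, ⟨-, hδ⟩, H⟩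
    exact ⟨N, δ, hδ, fun γ h1 h2 => H ⟨h1, γ.isMZ.1, h2⟩⟩
  · rintro ⟨N, δ, hδ, H⟩
    exact ⟨(N, δ), ⟨trivial, hδ⟩, fun γ hγ => H γ hγ.1 hγ.2.2⟩

variable {H : C(S2, SphL2)} {K : C(S2 × S2, ℝ)} {Y : (ℓ : ℕ) → Fin (2 * ℓ + 1) → C(S2, ℝ)}

/-- The operators of the scheme converge pointwise: the functions `K(x, ·) φ` form a compact set, so
they are approximated by `ℙ_n` uniformly in `x`. -/
theorem tendsto_schemeOp (hY : IsSphHarmonicSystem Y) (φ : C(S2, ℝ)) :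
    Tendsto (fun γ : MZRule => schemeOp H K Y γ.rule γ.degree φ) mzFilter
      (𝓝 (kernelOp H K toSphL2 φ)) := by
  rw [Metric.tendsto_nhds]
  intro ε hε
  set s := Real.sqrt (surf.real univ)
  -- `b (d, η)` bounds the error when all `K(x, ·) φ` are within `d` of `ℙ_n`.
  let b : ℝ × ℝ → ℝ := fun p => ‖H‖ * (3 * s * p.1 +
    Real.sqrt (p.2 ^ 2 + 4 * p.2) * (s * (‖K‖ * ‖φ‖ + p.1)))
  have hb : Continuous b := by fun_prop
  have hb0 : b (0, 0) = 0 := by simp [b]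
  obtain ⟨ρ, hρ, hball⟩ := Metric.mem_nhds_iff.1
    (hb.continuousAt.eventually_lt (continuousAt_const (y := ε)) (by rw [hb0]; exact hε))
  obtain ⟨N, hN⟩ := hY.exists_forall_norm_sub_lt
    (isCompact_range (by fun_prop : Continuous fun x => K.curry x * φ)) (half_pos hρ)
  refine eventually_mzFilter.2 ⟨N, ρ / 2, half_pos hρ, fun γ hn hη => ?_⟩
  have hbγ : b (ρ / 2, γ.const) < ε := hball (by
    rw [Metric.mem_ball, Prod.dist_eq, max_lt_iff]
    simp only [Real.dist_eq, sub_zero]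
    rw [abs_of_pos (half_pos hρ), abs_of_nonneg γ.isMZ.1]
    constructor <;> linarith)
  rw [dist_eq_norm, ContinuousMap.norm_lt_iff _ hε]
  intro x
  refine lt_of_le_of_lt (norm_kernelOp_sub_apply_le H K _ _ φ x) (lt_of_le_of_lt ?_ hbγ)
  refine mul_le_mul_of_nonneg_left ?_ (norm_nonneg _)
  obtain ⟨χ, hχ, hlt⟩ := hN _ hn _ (mem_range_self x)
  rw [ContinuousLinearMap.comp_apply, hyperinterpCLM_apply]
  refine (hY.norm_hyperinterp_sub_le γ.isMZ _ hχ).trans (add_le_add ?_ ?_)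
  · exact mul_le_mul_of_nonneg_left hlt.le (by positivity)
  · refine mul_le_mul_of_nonneg_left ?_ (Real.sqrt_nonneg _)
    rw [← norm_toSphL2]
    refine (norm_toSphL2_le χ).trans (mul_le_mul_of_nonneg_left ?_ (Real.sqrt_nonneg _))
    have h1 : ‖K.curry x * φ‖ ≤ ‖K‖ * ‖φ‖ :=
      (norm_mul_le _ _).trans (mul_le_mul_of_nonneg_right (norm_curry_le K x) (norm_nonneg _))
    have h2 := norm_sub_norm_le χ (K.curry x * φ)
    rw [norm_sub_rev] at h2
    linarith

/-- Uniform stability of the scheme. -/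
theorem exists_eventually_norm_le (hY : IsSphHarmonicSystem Y)
    (hinj : ∀ φ, φ = kernelOp H K toSphL2 φ → φ = 0) :
    ∃ c : ℝ, 0 < c ∧ ∀ᶠ γ : MZRule in mzFilter, ∀ φ,
      ‖φ‖ ≤ c * ‖φ - schemeOp H K Y γ.rule γ.degree φ‖ := by
  obtain ⟨S, hS, hmem⟩ := exists_isCompact_kernelOp_mem H K (2 * Real.sqrt (surf.real univ))
  refine eventually_norm_le_mul_norm_sub hS (.of_forall fun γ φ hφ => hmem _ ?_ φ hφ)
    (tendsto_schemeOp hY) hinj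
  refine ContinuousLinearMap.opNorm_le_bound _ (by positivity) fun g => ?_
  rw [ContinuousLinearMap.comp_apply, hyperinterpCLM_apply]
  exact hY.norm_hyperinterp_le γ.isMZ g

theorem norm_sub_le_of_norm_le {X : Type*} [NormedAddCommGroup X] [NormedSpace ℝ X]
    {A T : X →L[ℝ] X} {c : ℝ} (hc : ∀ φ, ‖φ‖ ≤ c * ‖φ - A φ‖) {f φ ψ : X} (hφ : φ - T φ = f)
    (hψ : ψ - A ψ = f) : ‖ψ - φ‖ ≤ c * ‖A φ - T φ‖ := by
  have h1 : ψ - φ - A (ψ - φ) = A φ - T φ := by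
    have h2 : ψ - φ - (A ψ - A φ) = (ψ - A ψ) - (φ - T φ) + (A φ - T φ) := by abel
    rw [map_sub, h2, hψ, hφ, sub_self, zero_add]
  exact h1 ▸ hc (ψ - φ)

/-- The consistency error is controlled at a point `x₀` where it is largest. -/
theorem exists_norm_schemeOp_sub_le (hY : IsSphHarmonicSystem Y) (γ : MZRule) (φ : C(S2, ℝ)) :
    ∃ x₀ : S2, ∀ χ ∈ sphPoly γ.degree,
      ‖schemeOp H K Y γ.rule γ.degree φ - kernelOp H K toSphL2 φ‖ ≤
        ‖H‖ * (3 * Real.sqrt (surf.real univ) * ‖kernelMul K x₀ φ - χ‖ +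
          Real.sqrt (γ.const ^ 2 + 4 * γ.const) * sphL2Norm χ) := by
  have hne : Nonempty S2 := (NormedSpace.sphere_nonempty.2 zero_le_one).to_subtype
  set u := schemeOp H K Y γ.rule γ.degree φ - kernelOp H K toSphL2 φ with hu
  obtain ⟨x₀, -, hx₀⟩ := isCompact_univ.exists_isMaxOn (univ_nonempty (α := S2))
    (by fun_prop : Continuous fun x => ‖u x‖).continuousOn
  refine ⟨x₀, fun χ hχ => ?_⟩
  refine ((ContinuousMap.norm_le _ (norm_nonneg _)).2 fun x => hx₀ (mem_univ x)).trans ?_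
  refine (norm_kernelOp_sub_apply_le H K _ _ φ x₀).trans ?_
  refine mul_le_mul_of_nonneg_left ?_ (norm_nonneg _)
  rw [ContinuousLinearMap.comp_apply, hyperinterpCLM_apply]
  exact hY.norm_hyperinterp_sub_le γ.isMZ _ hχ

end Convergence

/-- A fixed bound `c` is turned into a strictly decreasing constant by adding positive terms. -/
theorem isDecreasingConstant_add {c : ℝ} (hc : 0 ≤ c) :
    IsDecreasingConstant fun n η => c + 1 / ((n : ℝ) + 1) + η where
  pos n η hη := by
    have : 0 < 1 / ((n : ℝ) + 1) := by positivity
    linarith [hη.1]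
  anti η _ a b hab := by
    have : 1 / ((b : ℝ) + 1) < 1 / ((a : ℝ) + 1) :=
      one_div_lt_one_div_of_lt (by positivity) (by exact_mod_cast Nat.succ_lt_succ hab)
    simp only
    linarith
  mono n a _ b _ hab := by simpa using hab

theorem theorem3p1
    (h : ℝ → ℝ) (hweak : IsWeaklySingular h)
    (hL1 : MemLp (fun t : ℝ => h (Real.sqrt (2 * (1 - t)))) 1 (volume.restrict (Ioo (-1) 1)))
    (hL2 : MemLp (fun t : ℝ => h (Real.sqrt (2 * (1 - t)))) 2 (volume.restrict (Ioo (-1) 1)))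
    (K : C(S2 × S2, ℝ))
    (hhom : ∀ φ : C(S2, ℝ), IsExactSolution h K 0 φ → φ = 0)
    (Y : (ℓ : ℕ) → Fin (2 * ℓ + 1) → C(S2, ℝ)) (hY : IsSphHarmonicSystem Y) :
    (∀ f : C(S2, ℝ), ∃! φ : C(S2, ℝ), IsExactSolution h K f φ) ∧
    (∃ (N : ℕ) (η₀ : ℝ) (C₁ C₂ : ℕ → ℝ → ℝ), 0 < η₀ ∧
      IsDecreasingConstant C₁ ∧ IsDecreasingConstant C₂ ∧
      ∀ (m n : ℕ) (η : ℝ) (Q : SphQuadrature m), Q.IsMZ n η → N ≤ n → η ≤ η₀ →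
      ∀ f φ : C(S2, ℝ), IsExactSolution h K f φ →
        (∃! v : Fin m → ℝ, SolvesNodalSystem h K f Y Q n v) ∧
        ∃ φγ : C(S2, ℝ), IsSchemeSolution h K f Y Q n φγ ∧
          (∀ x : S2, φγ x
            - ∫ y, h (dist x y) * hyperinterp Y Q n (kernelMul K x φγ) y ∂surf = f x) ∧
          ‖φγ‖ ≤ C₁ n η * ‖f‖ ∧
          ∃ x₀ : S2, (∃ χ, IsBestApprox n (kernelMul K x₀ φ) χ) ∧
            ∀ χ, IsBestApprox n (kernelMul K x₀ φ) χ →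
              ‖φγ - φ‖ ≤ C₂ n η *
                (bestError n (kernelMul K x₀ φ) + Real.sqrt (η ^ 2 + 4 * η) * sphL2Norm χ)) ∧
    (∀ f φ : C(S2, ℝ), IsExactSolution h K f φ → ∀ ε > 0, ∃ (N : ℕ) (δ : ℝ), 0 < δ ∧
      ∀ (m n : ℕ) (η : ℝ) (Q : SphQuadrature m), Q.IsMZ n η → N ≤ n → η ≤ δ →
      ∃ φγ : C(S2, ℝ), (∀ ψ, IsSchemeSolution h K f Y Q n ψ ↔ ψ = φγ) ∧ ‖φγ - φ‖ < ε) := by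
  obtain ⟨H, hH⟩ := exists_continuous_zonal hL2
  have hinj : ∀ φ, φ = kernelOp H K toSphL2 φ → φ = 0 := fun φ hφ =>
    hhom φ ((isExactSolution_iff hH 0 φ).2 (sub_eq_zero.2 hφ))
  obtain ⟨c, hc, hstab⟩ := exists_eventually_norm_le hY hinj
  have hinj' : ∀ γ : MZRule, (∀ φ, ‖φ‖ ≤ c * ‖φ - schemeOp H K Y γ.rule γ.degree φ‖) →
      ∀ φ, φ = schemeOp H K Y γ.rule γ.degree φ → φ = 0 := fun γ hγ φ hφ => by
    have h1 := hγ φ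
    rw [← hφ, sub_self, norm_zero, mul_zero] at h1
    exact norm_le_zero_iff.1 h1
  refine ⟨fun f => ?_, ?_, fun f φ hφ ε hε => ?_⟩
  · obtain ⟨φ, hφ⟩ := (isCompactOperator_kernelOp H K toSphL2).exists_sub_eq hinj f
    refine ⟨φ, (isExactSolution_iff hH f φ).2 hφ, fun ψ hψ => ?_⟩
    have hψ' := (isExactSolution_iff hH f ψ).1 hψ
    refine sub_eq_zero.1 (hinj _ ?_)
    rw [map_sub]
    linear_combination hψ' - hφ
  · obtain ⟨N, η₀, hη₀, hN⟩ := eventually_mzFilter.1 hstab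
    set s := Real.sqrt (surf.real univ)
    refine ⟨N, η₀, _, _, hη₀, isDecreasingConstant_add hc.le,
      isDecreasingConstant_add (c := c * (‖H‖ * (3 * s + 1))) (by positivity),
      fun m n η Q hQ hn hη f φ hφ => ?_⟩
    let γ : MZRule := ⟨m, n, η, Q, hQ⟩
    have hγ := hN γ hn hη
    have hpos : 0 < 1 / ((n : ℝ) + 1) := by positivity
    obtain ⟨φγ, hφγ, hsys, hsol⟩ := exists_scheme_solution hH (hinj' γ hγ) f
    refine ⟨⟨_, (hsys _).2 rfl, fun v hv => (hsys v).1 hv⟩, φγ, (hsol _).2 rfl, fun x => ?_, ?_, ?_⟩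
    · rw [← schemeOp_apply hH, ← hφγ]; rfl
    · have h1 := hγ φγ
      rw [hφγ] at h1
      refine h1.trans (mul_le_mul_of_nonneg_right ?_ (norm_nonneg _))
      linarith [hQ.1]
    · obtain ⟨x₀, hx₀⟩ := exists_norm_schemeOp_sub_le (H := H) (K := K) hY γ φ
      refine ⟨x₀, exists_isBestApprox n _, fun χ hχ => ?_⟩
      have h1 := norm_sub_le_of_norm_le hγ ((isExactSolution_iff hH f φ).1 hφ) hφγ
      refine h1.trans ((mul_le_mul_of_nonneg_left (hx₀ χ hχ.1) hc.le).trans ?_)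
      rw [hχ.2]
      have hE : 0 ≤ bestError n (kernelMul K x₀ φ) := hχ.2 ▸ norm_nonneg _
      have hR : 0 ≤ Real.sqrt (η ^ 2 + 4 * η) * sphL2Norm χ :=
        mul_nonneg (Real.sqrt_nonneg _) (Real.sqrt_nonneg _)
      have hs : 0 ≤ s := Real.sqrt_nonneg _
      calc c * (‖H‖ * (3 * s * bestError n (kernelMul K x₀ φ) +
            Real.sqrt (η ^ 2 + 4 * η) * sphL2Norm χ))
          ≤ c * (‖H‖ * ((3 * s + 1) * bestError n (kernelMul K x₀ φ) +
            (3 * s + 1) * (Real.sqrt (η ^ 2 + 4 * η) * sphL2Norm χ))) := by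
            refine mul_le_mul_of_nonneg_left (mul_le_mul_of_nonneg_left (add_le_add ?_ ?_)
              (norm_nonneg H)) hc.le
            · exact mul_le_mul_of_nonneg_right (by linarith) hE
            · exact le_mul_of_one_le_left hR (by linarith)
        _ = c * (‖H‖ * (3 * s + 1)) * (bestError n (kernelMul K x₀ φ) +
            Real.sqrt (η ^ 2 + 4 * η) * sphL2Norm χ) := by ring
        _ ≤ _ := by
            refine mul_le_mul_of_nonneg_right ?_ (add_nonneg hE hR)
            linarith [hQ.1]
  · have hlim : ∀ᶠ γ : MZRule in mzFilter,
        ‖schemeOp H K Y γ.rule γ.degree φ - kernelOp H K toSphL2 φ‖ < ε / c := by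
      simpa [dist_eq_norm] using Metric.tendsto_nhds.1 (tendsto_schemeOp hY φ) (ε / c) (by positivity)
    obtain ⟨N, δ, hδ, hN⟩ := eventually_mzFilter.1 (hstab.and hlim)
    refine ⟨N, δ, hδ, fun m n η Q hQ hn hη => ?_⟩
    obtain ⟨hγ, hlt⟩ := hN ⟨m, n, η, Q, hQ⟩ hn hη
    obtain ⟨φγ, hφγ, -, hsol⟩ := exists_scheme_solution hH (hinj' ⟨m, n, η, Q, hQ⟩ hγ) f
    refine ⟨φγ, hsol, ?_⟩
    refine (norm_sub_le_of_norm_le hγ ((isExactSolution_iff hH f φ).1 hφ) hφγ).trans_lt ?_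
    rwa [lt_div_iff₀' hc] at hlt
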